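/- Consider $i\,u'(t)=(T+V(t))\,u(t)$ on $\mathbb{C}^N$, where $T$ is an $N\times N$ Hermitian matrix and $V(t)$ is a real diagonal matrix that is a $C^6$ function of $t\in\mathbb{R}$. Let $c_1=\frac12-\frac{\sqrt{15}}{10}$, $c_2=\frac12$, $c_3=\frac12+\frac{\sqrt{15}}{10}$ be the Gauss--Legendre nodes. For a step from $t$ to $t+\tau$ put $V_j=V(t+c_j\tau)$ and $$\alpha_1=\tau(T+V_2),\qquad \alpha_2=\tfrac{\sqrt{15}}{3}\tau(V_3-V_1),\qquad \alpha_3=\tfrac{10}{3}\tau(V_3-2V_2+V_1).$$ Say that a one-step method $\Phi$ is of order six if, for all $N$, $T$, $V$ as above and every compact time interval, there are $C$ and $\tau_0>0$ such that $\|U(t+\tau,t)-\Phi(t,\tau)\|\le C\tau^{7}$ for all $t$ in the interval and all $0\le\tau\le\tau_0$, where $U$ is the exact propagator. For a real $5\times 3$ matrix $x$ consider the composition $$\Phi_x=\prod_{i=5,4,\dots,1}\exp\bigl(-i\,(x_{i,1}\alpha_1+x_{i,2}\alpha_2+x_{i,3}\alpha_3)\bigr)$$ (factor $i=5$ leftmost;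 the $i$ in front of the bracket is the imaginary unit), subject to time symmetry $x_{6-i,j}=(-1)^{j+1}x_{i,j}$ and to $x_{1,1}=x_{1,3}=0$. Call $x$ a solution of the sixth-order conditions if, subject to these constraints, $\Phi_x$ is of order six. Then there is a solution $x$ of the sixth-order conditions such that every other solution $y$ has $\sum_{i,j}|x_{i,j}|<\sum_{i,j}|y_{i,j}|$. Put $a_{i,j}=\sum_{k=1}^3x_{i,k}G_{k,j}$ for $i=1,2,3$, where $$G=\begin{pmatrix}0&1&0\\-\frac{\sqrt{15}}3&0&\frac{\sqrt{15}}3\\ \frac{10}3&-\frac{20}3&\frac{10}3\end{pmatrix},$$ $a_i=\sum_{j}a_{i,j}$, $\bar V_i=\sum_{j}a_{i,j}V_j$ for $i=1,2,3$, $\bar V_4=\sum_j a_{2,4-j}V_j$ and $\bar V_5=\sum_j a_{1,4-j}V_j$. Then for this $x$ $$\Phi_x=\Upsilon_3^{[6]}:=e^{-i\tau\bar V_5}\,e^{-i\tau(a_2T+\bar V_4)}\,e^{-i\tau(a_3T+\bar V_3)}\,e^{-i\tau(a_2T+\bar V_2)}\,e^{-i\tau\bar V_1}$$ holds for all $T$,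 $V$, $t$, $\tau$; the method $\Upsilon_3^{[6]}$ is of order six; its two outer exponentials are diagonal matrices; and its coefficients satisfy $a_{1,2}=0$, $a_{1,3}=-a_{1,1}$, $a_{3,3}=a_{3,1}$, $a_3=1-2a_2$ and, each correctly rounded to the digits shown (error at most half a unit in the last digit), $$\begin{aligned} a_{1,1}&\approx 0.01994096265093610745, & a_{2,1}&\approx 0.4882524910228221957,\\ a_{2,2}&\approx -0.0046136830175630621, & a_{2,3}&\approx 0.0834019108602182940,\\ a_{3,1}&\approx -0.29387662410526271191, & a_{3,2}&\approx 0.4536718104795705687,\\ a_{2}&\approx 0.56704071886547742757, & a_3&\approx -0.13408143773095485515. \end{aligned}$$ -/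

import Mathlib

namespace CommutatorFree

noncomputable section

open scoped Matrix.Norms.L2Operator

/-- The nodes `c₁, c₂, c₃` on `[0, 1]` of the sixth-order Gauss–Legendre quadrature rule. -/
def node : Fin 3 → ℝ := ![1 / 2 - √15 / 10, 1 / 2, 1 / 2 + √15 / 10]

/-- The real diagonal matrix with diagonal `v`: a potential on a grid of `N` points. -/
def potential {N : ℕ} (v : Fin N → ℝ) : Matrix (Fin N) (Fin N) ℂ :=
  Matrix.diagonal fun k => (v k : ℂ)

/-- The Hamiltonian `H(t) = T + V(t)`. -/
def hamiltonian {N : ℕ} (T : Matrix (Fin N) (Fin N) ℂ) (V : ℝ → Fin N → ℝ) (t : ℝ) :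
    Matrix (Fin N) (Fin N) ℂ :=
  T + potential (V t)

/-- `U` is the propagator of `i u'(t) = H(t) u(t)`: the solution with value `u₀` at time `s` is
`t ↦ U t s * u₀`. -/
def IsPropagator {N : ℕ} (H : ℝ → Matrix (Fin N) (Fin N) ℂ)
    (U : ℝ → ℝ → Matrix (Fin N) (Fin N) ℂ) : Prop :=
  ∀ s, U s s = 1 ∧ ∀ t, HasDerivAt (fun r => U r s) (-Complex.I • (H t * U t s)) t

/-- Terms of the Dyson series of `U' = A(t) U`, `U(s) = 1`. -/
def dysonTerm {E : Type*} [NormedRing E] [NormedAlgebra ℝ E]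
    (A : ℝ → E) (s : ℝ) : ℕ → ℝ → E
  | 0 => fun _ => 1
  | n + 1 => fun t => ∫ r in s..t, A r * dysonTerm A s n r

theorem dysonTerm_continuous {E : Type*} [NormedRing E] [NormedAlgebra ℝ E]
    {A : ℝ → E} (hA : Continuous A) (s : ℝ) (n : ℕ) : Continuous (dysonTerm A s n) := by
  induction n with
  | zero => exact continuous_const
  | succ n ih =>
    exact intervalIntegral.continuous_primitive
      (fun a b => (hA.mul ih).intervalIntegrable a b) s

theorem norm_dysonTerm_le {E : Type*} [NormedRing E] [NormedAlgebra ℝ E]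
    {A : ℝ → E} {s R M : ℝ} (hM : ∀ t, |t - s| ≤ R → ‖A t‖ ≤ M) (hM0 : 0 ≤ M)
    (n : ℕ) (t : ℝ) (ht : |t - s| ≤ R) :
    ‖dysonTerm A s n t‖ ≤ ‖(1 : E)‖ * (M ^ n * (|t - s| ^ n / n.factorial)) := by
  induction n generalizing t with
  | zero => simp [dysonTerm]
  | succ n ih =>
    have key : ∀ r ∈ Set.uIoc s t, ‖A r * dysonTerm A s n r‖ ≤
        ‖(1 : E)‖ * M ^ (n + 1) / n.factorial * |r - s| ^ n := by
      intro r hr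
      have h1 : |r - s| ≤ |t - s| := by
        rcases Set.mem_uIoc.1 hr with h | h
        · rw [abs_of_pos (by linarith), abs_of_pos (by linarith)]; linarith
        · rw [abs_of_nonpos (by linarith), abs_of_nonpos (by linarith)]; linarith
      calc ‖A r * dysonTerm A s n r‖ ≤ ‖A r‖ * ‖dysonTerm A s n r‖ := norm_mul_le _ _
        _ ≤ M * (‖(1 : E)‖ * (M ^ n * (|r - s| ^ n / n.factorial))) := by
            gcongr
            · exact hM r (h1.trans ht)
            · exact ih r (h1.trans ht)
        _ = _ := by ring
    have h2 : ‖∫ r in s..t, A r * dysonTerm A s n r‖ ≤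
        |∫ r in s..t, ‖(1 : E)‖ * M ^ (n + 1) / n.factorial * |r - s| ^ n| := by
      apply intervalIntegral.norm_integral_le_abs_of_norm_le
      · exact (MeasureTheory.ae_restrict_mem measurableSet_uIoc).mono key
      · exact Continuous.intervalIntegrable (by fun_prop) _ _
    have h3 : |∫ r in s..t, ‖(1 : E)‖ * M ^ (n + 1) / n.factorial * |r - s| ^ n| =
        ‖(1 : E)‖ * M ^ (n + 1) / n.factorial * (|t - s| ^ (n + 1) / (n + 1)) := by
      rw [intervalIntegral.integral_const_mul, abs_mul, abs_of_nonneg (by positivity),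
        intervalIntegral.abs_integral_eq_abs_integral_uIoc, integral_pow_abs_sub_uIoc,
        abs_of_nonneg (by positivity)]
    refine (h2.trans_eq h3).trans_eq ?_
    rw [Nat.factorial_succ]; push_cast; field_simp

theorem exists_linear_ode_solution {E : Type*} [NormedRing E] [NormedAlgebra ℝ E]
    [CompleteSpace E] {A : ℝ → E} (hA : Continuous A) (s : ℝ) :
    ∃ U : ℝ → E, U s = 1 ∧ ∀ t, HasDerivAt U (A t * U t) t := by
  have h0 : ∀ n, dysonTerm A s (n + 1) s = 0 := fun n => by simp [dysonTerm]
  refine ⟨fun t => ∑' n, dysonTerm A s n t, ?_, fun t => ?_⟩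
  · show ∑' n, dysonTerm A s n s = 1
    rw [tsum_eq_single 0 (fun n hn => ?_)]
    · rfl
    · obtain ⟨m, rfl⟩ := Nat.exists_eq_succ_of_ne_zero hn
      exact h0 m
  · set R := |t - s| + 1
    obtain ⟨M, hM⟩ := (isCompact_Icc (a := s - R) (b := s + R)).exists_bound_of_continuousOn
      hA.continuousOn
    have hM' : ∀ r, |r - s| ≤ R → ‖A r‖ ≤ M := fun r hr =>
      hM r ⟨by linarith [(abs_le.1 hr).1], by linarith [(abs_le.1 hr).2]⟩
    have hM0 : 0 ≤ M := (norm_nonneg _).trans (hM' s (by simp [R]; positivity))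
    have hsum : Summable fun n : ℕ => ‖(1 : E)‖ * (M ^ n * (R ^ n / n.factorial)) := by
      simp_rw [← mul_div_assoc, ← mul_pow]
      simpa [mul_div_assoc] using (Real.summable_pow_div_factorial (M * R)).mul_left ‖(1 : E)‖
    have hb : ∀ n r, |r - s| ≤ R →
        ‖dysonTerm A s n r‖ ≤ ‖(1 : E)‖ * (M ^ n * (R ^ n / n.factorial)) := fun n r hr =>
      (norm_dysonTerm_le hM' hM0 n r hr).trans (by gcongr)
    have hs : ∀ r, |r - s| ≤ R → Summable fun n => dysonTerm A s n r := fun r hr =>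
      Summable.of_norm_bounded hsum fun n => hb n r hr
    have hd : ∀ n r, HasDerivAt (dysonTerm A s (n + 1)) (A r * dysonTerm A s n r) r :=
      fun n r => by
        have hc : Continuous fun x => A x * dysonTerm A s n x :=
          hA.mul (dysonTerm_continuous hA s n)
        exact intervalIntegral.integral_hasDerivAt_right (hc.intervalIntegrable _ _)
          (hc.stronglyMeasurableAtFilter _ _) hc.continuousAt
    have hlt : |t - s| < R := by simp [R]
    have hball : ∀ r ∈ Metric.ball s R, |r - s| ≤ R := fun r hr => by
      rw [Metric.mem_ball, Real.dist_eq] at hr; exact hr.le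
    have hmain : HasDerivAt (fun r => ∑' n, dysonTerm A s (n + 1) r)
        (∑' n, A t * dysonTerm A s n t) t := by
      refine hasDerivAt_tsum_of_isPreconnected (hsum.mul_left M) Metric.isOpen_ball
        (convex_ball s R).isPreconnected (fun n r _ => hd n r) (fun n r hr => ?_)
        (y₀ := s) (Metric.mem_ball_self (by positivity)) ?_
        (by rwa [Metric.mem_ball, Real.dist_eq])
      · refine (norm_mul_le _ _).trans ?_
        gcongr
        · exact hM' r (hball r hr)
        · exact hb n r (hball r hr)
      · simp [h0]
    rw [(hs t hlt.le).tsum_mul_left] at hmain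
    have heq : (fun r => ∑' n, dysonTerm A s n r) =ᶠ[nhds t]
        fun r => 1 + ∑' n, dysonTerm A s (n + 1) r := by
      filter_upwards [Metric.isOpen_ball.mem_nhds
        (show t ∈ Metric.ball s R by rwa [Metric.mem_ball, Real.dist_eq])] with r hr
      rw [(hs r (hball r hr)).tsum_eq_zero_add]
      rfl
    exact (hmain.const_add 1).congr_of_eventuallyEq heq

/-- A Hamiltonian with continuous potential has a propagator. -/
theorem exists_isPropagator {N : ℕ} (T : Matrix (Fin N) (Fin N) ℂ) {V : ℝ → Fin N → ℝ}
    (hV : Continuous V) : ∃ U, IsPropagator (hamiltonian T V) U := by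
  have hA : Continuous fun t => -Complex.I • hamiltonian T V t := by
    have h : Continuous fun t => potential (V t) :=
      Continuous.matrix_diagonal (by fun_prop)
    have h' : Continuous fun t => hamiltonian T V t := continuous_const.add h
    exact h'.const_smul (-Complex.I)
  choose U h1 hU using fun s => exists_linear_ode_solution hA s
  refine ⟨fun t s => U s t, fun s => ⟨h1 s, fun t => ?_⟩⟩
  simpa only [smul_mul_assoc] using hU s t

/-- A one-step integrator: it takes `T`, `V`, the current time `t` and the step size `τ`, and
returns the matrix that advances the numerical solution from time `t` to time `t + τ`. -/
abbrev Integrator : Type :=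
  ∀ N : ℕ, Matrix (Fin N) (Fin N) ℂ → (ℝ → Fin N → ℝ) → ℝ → ℝ → Matrix (Fin N) (Fin N) ℂ

/-- The integrator `Φ` is of order `p` for `i u' = (T + V(t)) u`: for every Hermitian `T` and every
real diagonal `V` of class `C^p`, one step reproduces the exact propagator up to `O(τ^(p+1))`,
uniformly for initial times in a compact interval. -/
def IsOfOrder (p : ℕ) (Φ : Integrator) : Prop :=
  ∀ (N : ℕ) (T : Matrix (Fin N) (Fin N) ℂ), T.IsHermitian →
  ∀ V : ℝ → Fin N → ℝ, ContDiff ℝ p V →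
  ∀ U : ℝ → ℝ → Matrix (Fin N) (Fin N) ℂ, IsPropagator (hamiltonian T V) U →
  ∀ t₀ t₁ : ℝ, ∃ C τ₀ : ℝ, 0 < τ₀ ∧ ∀ t ∈ Set.Icc t₀ t₁, ∀ τ ∈ Set.Icc 0 τ₀,
    ‖U (t + τ) t - Φ N T V t τ‖ ≤ C * τ ^ (p + 1)

/-- The potential `V_j = V(t + c_j τ)` at the `j`-th quadrature node. -/
def nodePotential {N : ℕ} (V : ℝ → Fin N → ℝ) (t τ : ℝ) (j : Fin 3) :
    Matrix (Fin N) (Fin N) ℂ :=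
  potential (V (t + node j * τ))

/-- The combinations `α₁ = τ (T + V₂)`, `α₂ = τ (√15 / 3) (V₃ - V₁)`,
`α₃ = τ (10 / 3) (V₃ - 2 V₂ + V₁)`. -/
def alpha {N : ℕ} (T : Matrix (Fin N) (Fin N) ℂ) (V : ℝ → Fin N → ℝ) (t τ : ℝ) :
    Fin 3 → Matrix (Fin N) (Fin N) ℂ :=
  let W := nodePotential V t τ
  ![(τ : ℂ) • (T + W 1),
    ((τ * (√15 / 3) : ℝ) : ℂ) • (W 2 - W 0),
    ((τ * (10 / 3) : ℝ) : ℂ) • (W 2 - (2 : ℂ) • W 1 + W 0)]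

/-- The matrix `G` that expresses `α₁, α₂, α₃` through the values at the three nodes. -/
def G : Matrix (Fin 3) (Fin 3) ℝ :=
  !![0, 1, 0;
     -(√15 / 3), 0, √15 / 3;
     10 / 3, -(20 / 3), 10 / 3]

/-- The five-exponential composition
`exp(-i ∑ⱼ x_{5,j} αⱼ) ⋯ exp(-i ∑ⱼ x_{1,j} αⱼ)`. -/
def composition (x : Matrix (Fin 5) (Fin 3) ℝ) : Integrator := fun _ T V t τ =>
  let E := fun i : Fin 5 =>
    NormedSpace.exp (-Complex.I • ∑ j, (x i j : ℂ) • alpha T V t τ j)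
  E 4 * E 3 * E 2 * E 1 * E 0

/-- The time-symmetric compositions (`x_{6-i,j} = (-1)^{j+1} x_{i,j}` with indices from `1`) whose
outer exponents are multiples of `α₂` (`x_{1,1} = x_{1,3} = 0`). -/
def IsAdmissible (x : Matrix (Fin 5) (Fin 3) ℝ) : Prop :=
  (∀ i j, x i.rev j = (-1) ^ (j : ℕ) * x i j) ∧ x 0 0 = 0 ∧ x 0 2 = 0

/-- `∑_{i,j} |x_{i,j}|`. -/
def coeffSum (x : Matrix (Fin 5) (Fin 3) ℝ) : ℝ := ∑ i, ∑ j, |x i j|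

/-- The averaged potential `∑ⱼ cⱼ Vⱼ`. -/
def averagedPotential {N : ℕ} (c : Fin 3 → ℝ) (V : ℝ → Fin N → ℝ) (t τ : ℝ) :
    Matrix (Fin N) (Fin N) ℂ :=
  ∑ j, (c j : ℂ) • nodePotential V t τ j

/-- The potentials `V̄₁, …, V̄₅`; the coefficients of `V̄₄` and `V̄₅` are those of `V̄₂` and `V̄₁` in
reverse order. -/
def barV {N : ℕ} (a : Matrix (Fin 3) (Fin 3) ℝ) (V : ℝ → Fin N → ℝ) (t τ : ℝ) :
    Fin 5 → Matrix (Fin N) (Fin N) ℂ :=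
  ![averagedPotential (a 0) V t τ,
    averagedPotential (a 1) V t τ,
    averagedPotential (a 2) V t τ,
    averagedPotential (fun j => a 1 j.rev) V t τ,
    averagedPotential (fun j => a 0 j.rev) V t τ]

/-- The row sum `a_i = ∑ⱼ a_{i,j}`. -/
def rowSum (a : Matrix (Fin 3) (Fin 3) ℝ) (i : Fin 3) : ℝ := ∑ j, a i j

/-- The scheme `exp(-iτV̄₅) exp(-iτ(a₂T+V̄₄)) exp(-iτ(a₃T+V̄₃)) exp(-iτ(a₂T+V̄₂)) exp(-iτV̄₁)`. -/
def upsilon (a : Matrix (Fin 3) (Fin 3) ℝ) : Integrator := fun _ T V t τ =>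
  let W := barV a V t τ
  NormedSpace.exp ((-Complex.I * τ) • W 4) *
  NormedSpace.exp ((-Complex.I * τ) • ((rowSum a 1 : ℂ) • T + W 3)) *
  NormedSpace.exp ((-Complex.I * τ) • ((rowSum a 2 : ℂ) • T + W 2)) *
  NormedSpace.exp ((-Complex.I * τ) • ((rowSum a 1 : ℂ) • T + W 1)) *
  NormedSpace.exp ((-Complex.I * τ) • W 0)

end

end CommutatorFree

namespace CommutatorFree

open Filter Asymptotics Topology

/-! ### Asymptotic expansions in the step size with parameter-dependent coefficients. -/

section Expansion

variable {α β E F : Type*} [NormedRing E] [NormedAlgebra ℝ E] {l : Filter α} {τ : α → ℝ}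

/-! Both the propagator and the composition are expanded about the midpoint m of the step, in powers
of the step size s. With A = -iH and a_j the j-th Taylor coefficient of A at m, each coefficient is
a noncommutative polynomial in the a_j, where a_j has weight j + 1. The propagator Y(s) = U(m + s/2,
m - s/2) solves Y' = (A(m + s/2) Y + Y A(m - s/2))/2, which gives its coefficients by the recursion
`midCoeff`; the composition gives the word series `compSeries`. Order six means that the two agree
through weight 6. Remainders are uniform for m in a compact set.

Both sides satisfy Y(-s) Y(s) = 1, so the even coefficients follow from the odd ones
(`coeff_eq_of_odd_coeff_eq`) and only weights 1, 3 and 5 have to be compared. The derivatives of V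
are diagonal, so a_1 and a_2 commute and the condition on their commutator disappears. What remains
for q = x_{1,2}, p = x_{2,1}, r = x_{2,2}, s = x_{2,3} is `SixthOrderEquations`; the two other free
entries are fixed linearly by p and s.

Conversely, these equations are necessary: a single two-level problem with T = σ₁ and V = (t + t²)σ₃
already detects each of them (`sixthOrderEquations_of_isOfOrder`).

Eliminating q, r, s leaves 15p(1-p)⁴ + 3p - 2 = 0, which has exactly one real root. Thus the
sixth-order conditions have exactly one admissible solution, and the minimality of its coefficient
sum holds because there is no competitor. The decimals follow by interval arithmetic from a narrow
enclosure of the root and of √15. -/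

theorem isBigO_pow_of_le (hτ : Tendsto τ l (𝓝 0)) {m n : ℕ} (h : m ≤ n) :
    (fun p => τ p ^ n) =O[l] fun p => τ p ^ m := by
  have h1 : (fun p => τ p ^ (n - m)) =O[l] fun _ => (1 : ℝ) := (hτ.pow (n - m)).isBigO_one ℝ
  have h2 := (isBigO_refl (fun p => τ p ^ m) l).mul h1
  simpa [← pow_add, Nat.add_sub_cancel' h] using h2

theorem isBigO_finset_sum {ι G : Type*} [SeminormedAddCommGroup G] {g : α → ℝ} {s : Finset ι}
    {f : ι → α → G} (h : ∀ i ∈ s, f i =O[l] g) : (fun p => ∑ i ∈ s, f i p) =O[l] g := by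
  simpa only [Finset.sum_fn] using IsBigO.sum h

/-- `f = ∑_{k < n} τ^k φ_k + O(τ^n)` along `l`, with bounded coefficients `φ_k`. -/
structure IsExpansion (l : Filter α) (τ : α → ℝ) (n : ℕ) (f : α → E) (φ : ℕ → α → E) :
    Prop where
  coeff : ∀ k < n, φ k =O[l] fun _ => (1 : ℝ)
  remainder : (fun p => f p - ∑ k ∈ Finset.range n, τ p ^ k • φ k p) =O[l] fun p => τ p ^ n

namespace IsExpansion

variable {n : ℕ} {f g : α → E} {φ ψ : ℕ → α → E}

theorem isBigO_term (h : IsExpansion l τ n f φ) {k : ℕ} (hk : k < n) :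
    (fun p => τ p ^ k • φ k p) =O[l] fun p => τ p ^ k := by
  simpa using (isBigO_refl (fun p => τ p ^ k) l).smul (h.coeff k hk)

theorem isBigO_sum (hτ : Tendsto τ l (𝓝 0)) (h : IsExpansion l τ n f φ) :
    (fun p => ∑ k ∈ Finset.range n, τ p ^ k • φ k p) =O[l] fun _ => (1 : ℝ) := by
  refine isBigO_finset_sum fun k hk => ?_
  simpa using (h.isBigO_term (Finset.mem_range.1 hk)).trans (isBigO_pow_of_le hτ (Nat.zero_le k))

theorem isBigO_one (hτ : Tendsto τ l (𝓝 0)) (h : IsExpansion l τ n f φ) :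
    f =O[l] fun _ => (1 : ℝ) := by
  have h1 : (fun p => f p - ∑ k ∈ Finset.range n, τ p ^ k • φ k p) =O[l] fun _ => (1 : ℝ) := by
    simpa using h.remainder.trans (isBigO_pow_of_le hτ (Nat.zero_le n))
  simpa using h1.add (h.isBigO_sum hτ)

theorem congr_coeff (h : IsExpansion l τ n f φ) (hφ : ∀ k < n, ∀ p, φ k p = ψ k p) :
    IsExpansion l τ n f ψ := by
  refine ⟨fun k hk => (h.coeff k hk).congr_left (hφ k hk), h.remainder.congr_left fun p => ?_⟩
  congr 1
  exact Finset.sum_congr rfl fun k hk => by rw [hφ k (Finset.mem_range.1 hk)]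

theorem congr_left (h : IsExpansion l τ n f φ) (hf : ∀ p, f p = g p) :
    IsExpansion l τ n g φ :=
  ⟨h.coeff, h.remainder.congr_left fun p => by rw [hf]⟩

theorem comp_tendsto {l' : Filter β} {u : β → α} (hu : Tendsto u l' l)
    (h : IsExpansion l τ n f φ) :
    IsExpansion l' (τ ∘ u) n (f ∘ u) fun k => φ k ∘ u :=
  ⟨fun k hk => (h.coeff k hk).comp_tendsto hu, h.remainder.comp_tendsto hu⟩

theorem truncate (hτ : Tendsto τ l (𝓝 0)) (h : IsExpansion l τ n f φ) {m : ℕ} (hm : m ≤ n) :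
    IsExpansion l τ m f φ := by
  refine ⟨fun k hk => h.coeff k (hk.trans_le hm), ?_⟩
  have h1 : (fun p => ∑ k ∈ Finset.Ico m n, τ p ^ k • φ k p) =O[l] fun p => τ p ^ m :=
    isBigO_finset_sum fun k hk => (h.isBigO_term (Finset.mem_Ico.1 hk).2).trans
      (isBigO_pow_of_le hτ (Finset.mem_Ico.1 hk).1)
  refine ((h.remainder.trans (isBigO_pow_of_le hτ hm)).add h1).congr_left fun p => ?_
  rw [← Finset.sum_range_add_sum_Ico _ hm]
  abel

theorem add (hf : IsExpansion l τ n f φ) (hg : IsExpansion l τ n g ψ) :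
    IsExpansion l τ n (fun p => f p + g p) fun k p => φ k p + ψ k p := by
  refine ⟨fun k hk => (hf.coeff k hk).add (hg.coeff k hk), ?_⟩
  refine (hf.remainder.add hg.remainder).congr_left fun p => ?_
  simp only [smul_add, Finset.sum_add_distrib]
  abel

theorem const_smul (c : ℝ) (hf : IsExpansion l τ n f φ) :
    IsExpansion l τ n (fun p => c • f p) fun k p => c • φ k p := by
  refine ⟨fun k hk => (hf.coeff k hk).const_smul_left c, ?_⟩
  refine (hf.remainder.const_smul_left c).congr_left fun p => ?_
  simp only [Pi.smul_apply, smul_sub, Finset.smul_sum]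
  congr 1
  exact Finset.sum_congr rfl fun k _ => smul_comm _ _ _

theorem sub (hf : IsExpansion l τ n f φ) (hg : IsExpansion l τ n g ψ) :
    IsExpansion l τ n (fun p => f p - g p) fun k p => φ k p - ψ k p := by
  simpa [sub_eq_add_neg] using hf.add (hg.const_smul (-1))

theorem sum {ι : Type*} (s : Finset ι) {f : ι → α → E} {φ : ι → ℕ → α → E}
    (h : ∀ i ∈ s, IsExpansion l τ n (f i) (φ i)) :
    IsExpansion l τ n (fun p => ∑ i ∈ s, f i p) fun k p => ∑ i ∈ s, φ i k p := by
  refine ⟨fun k hk => isBigO_finset_sum fun i hi => (h i hi).coeff k hk, ?_⟩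
  refine (isBigO_finset_sum fun i hi => (h i hi).remainder).congr_left fun p => ?_
  simp only [Finset.smul_sum, Finset.sum_sub_distrib]
  rw [Finset.sum_comm]

theorem add_isBigO (hf : IsExpansion l τ n f φ) (hg : g =O[l] fun p => τ p ^ n) :
    IsExpansion l τ n (fun p => f p + g p) φ :=
  ⟨hf.coeff, (hf.remainder.add hg).congr_left fun p => by abel⟩

theorem one : IsExpansion l τ n (fun _ => (1 : E)) fun k _ => if k = 0 then 1 else 0 := by
  refine ⟨fun k _ => isBigO_const_const _ one_ne_zero _, ?_⟩
  rcases n with _ | n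
  · simpa using isBigO_const_const (1 : E) (one_ne_zero (α := ℝ)) l
  · refine (isBigO_zero _ _).congr_left fun p => ?_
    simp

theorem mul (hτ : Tendsto τ l (𝓝 0)) (hf : IsExpansion l τ n f φ)
    (hg : IsExpansion l τ n g ψ) :
    IsExpansion l τ n (fun p => f p * g p)
      fun k p => ∑ i ∈ Finset.range (k + 1), φ i p * ψ (k - i) p := by
  constructor
  · intro k hk
    refine isBigO_finset_sum fun i hi => ?_
    simpa using (hf.coeff i (by grind)).mul (hg.coeff (k - i) (by grind))
  · have h1 := hf.remainder.mul (hg.isBigO_one hτ)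
    have h2 := (hf.isBigO_sum hτ).mul hg.remainder
    -- These are the cross terms of total degree at least n, which the truncated Cauchy product
    -- omits.
    have h3 : (fun p => ∑ i ∈ Finset.range n, ∑ j ∈ Finset.Ico (n - i) n,
        (τ p ^ i • φ i p) * (τ p ^ j • ψ j p)) =O[l] fun p => τ p ^ n := by
      refine isBigO_finset_sum fun i hi => isBigO_finset_sum fun j hj => ?_
      have hj' := Finset.mem_Ico.1 hj
      have hi' := Finset.mem_range.1 hi
      refine ((hf.isBigO_term hi').mul (hg.isBigO_term hj'.2)).trans ?_
      simp only [← pow_add]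
      exact isBigO_pow_of_le hτ (by omega)
    simp only [mul_one, one_mul] at h1 h2
    refine ((h1.add h2).add h3).congr_left fun p => ?_
    have h4 : ∑ k ∈ Finset.range n, τ p ^ k • ∑ i ∈ Finset.range (k + 1),
        φ i p * ψ (k - i) p = ∑ i ∈ Finset.range n, ∑ j ∈ Finset.range (n - i),
          (τ p ^ i • φ i p) * (τ p ^ j • ψ j p) := by
      rw [← Finset.sum_range_diag_flip]
      refine Finset.sum_congr rfl fun k _ => ?_
      rw [Finset.smul_sum]
      refine Finset.sum_congr rfl fun i hi => ?_
      rw [smul_mul_smul_comm, ← pow_add, Nat.add_sub_cancel' (by grind)]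
    have h5 : (∑ k ∈ Finset.range n, τ p ^ k • φ k p) * ∑ k ∈ Finset.range n, τ p ^ k • ψ k p =
        (∑ i ∈ Finset.range n, ∑ j ∈ Finset.range (n - i),
          (τ p ^ i • φ i p) * (τ p ^ j • ψ j p)) + ∑ i ∈ Finset.range n,
          ∑ j ∈ Finset.Ico (n - i) n, (τ p ^ i • φ i p) * (τ p ^ j • ψ j p) := by
      rw [Finset.sum_mul_sum, ← Finset.sum_add_distrib]
      refine Finset.sum_congr rfl fun i _ => ?_
      rw [Finset.sum_range_add_sum_Ico _ (Nat.sub_le n i)]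
    rw [h4, eq_sub_of_add_eq h5.symm]
    noncomm_ring

/-- If all coefficients below `k` vanish, then `f = τ^k φ_k + O(τ^(k+1))`. -/
theorem sub_leading (hτ : Tendsto τ l (𝓝 0)) (h : IsExpansion l τ n f φ) {k : ℕ} (hk : k < n)
    (h0 : ∀ j < k, ∀ p, φ j p = 0) :
    (fun p => f p - τ p ^ k • φ k p) =O[l] fun p => τ p ^ (k + 1) := by
  refine (h.truncate hτ (Nat.succ_le_of_lt hk)).remainder.congr_left fun p => ?_
  rw [Finset.sum_range_succ, Finset.sum_eq_zero, zero_add]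
  intro j hj
  rw [h0 j (Finset.mem_range.1 hj), smul_zero]

end IsExpansion

theorem eq_zero_of_pow_smul_isBigO [l.NeBot] (hτ : Tendsto τ l (𝓝 0))
    (hne : ∀ᶠ p in l, τ p ≠ 0) {n : ℕ} {e : E}
    (h : (fun p => τ p ^ n • e) =O[l] fun p => τ p ^ (n + 1)) : e = 0 := by
  have h1 := (isBigO_refl (fun p => (τ p ^ n)⁻¹) l).smul h
  have h2 : (fun _ : α => e) =O[l] τ := by
    refine h1.congr' ?_ ?_
    · filter_upwards [hne] with p hp
      rw [inv_smul_smul₀ (pow_ne_zero n hp)]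
    · filter_upwards [hne] with p hp
      rw [smul_eq_mul, pow_succ, inv_mul_cancel_left₀ (pow_ne_zero n hp)]
  exact tendsto_nhds_unique tendsto_const_nhds (h2.trans_tendsto hτ)

/-- Coefficients of expansions in one variable are unique. -/
theorem IsExpansion.coeff_eq_zero [l.NeBot] (hτ : Tendsto τ l (𝓝 0))
    (hne : ∀ᶠ p in l, τ p ≠ 0) {n : ℕ} {f : α → E} {φ : ℕ → E}
    (h : IsExpansion l τ n f fun k _ => φ k) (hf : f =O[l] fun p => τ p ^ n) :
    ∀ k < n, φ k = 0 := by
  intro k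
  induction k using Nat.strong_induction_on with
  | _ k ih =>
    intro hk
    have h1 := h.sub_leading hτ hk fun j hj _ => ih j hj (hj.trans hk)
    have h2 := (hf.trans (isBigO_pow_of_le hτ (Nat.succ_le_of_lt hk))).sub h1
    exact eq_zero_of_pow_smul_isBigO hτ hne (h2.congr_left fun p => by abel)

/-- Two time-symmetric functions whose expansions have equal odd coefficients have equal
expansions. -/
theorem coeff_eq_of_odd_coeff_eq {n : ℕ} {f g : ℝ → E} {φ ψ : ℕ → E}
    (hf : IsExpansion (𝓝[≠] (0 : ℝ)) id n f fun k _ => φ k)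
    (hg : IsExpansion (𝓝[≠] (0 : ℝ)) id n g fun k _ => ψ k)
    (hf0 : φ 0 = 1) (hg0 : ψ 0 = 1) (hfs : ∀ s, f (-s) * f s = 1) (hgs : ∀ s, g (-s) * g s = 1)
    (hodd : ∀ k < n, Odd k → φ k = ψ k) : ∀ k < n, φ k = ψ k := by
  have hτ : Tendsto (id : ℝ → ℝ) (𝓝[≠] 0) (𝓝 0) := tendsto_id.mono_left nhdsWithin_le_nhds
  have hneg : Tendsto (fun s : ℝ => -s) (𝓝[≠] 0) (𝓝[≠] 0) := by
    refine tendsto_nhdsWithin_of_tendsto_nhds_of_eventually_within _ ?_ ?_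
    · have : Tendsto (fun s : ℝ => -s) (𝓝 0) (𝓝 0) := by
        simpa using (continuous_neg (G := ℝ)).tendsto 0
      exact this.mono_left nhdsWithin_le_nhds
    · filter_upwards [self_mem_nhdsWithin] with s hs
      simpa using hs
  intro k
  induction k using Nat.strong_induction_on with
  | _ k ih =>
    intro hk
    rcases Nat.even_or_odd k with hev | hod
    · rcases Nat.eq_zero_or_pos k with rfl | hpos
      · rw [hf0, hg0]
      -- Write f - g = s^k d + O(s^(k+1)). For even k the same holds at -s. Expanding 0 = f(-s)f(s)
      -- - g(-s)g(s) = (f(-s) - g(-s)) f(s) + g(-s) (f(s) - g(s)), with f and g equal to 1 + O(s),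
      -- gives 2 s^k d = O(s^(k+1)), so d = 0. For odd k the two contributions would cancel.
      have h1 : (fun s : ℝ => (f s - g s) - s ^ k • (φ k - ψ k)) =O[𝓝[≠] 0]
          fun s => s ^ (k + 1) :=
        (hf.sub hg).sub_leading hτ hk fun j hj _ => sub_eq_zero.2 (ih j hj (hj.trans hk))
      have h2 : (fun s : ℝ => (f (-s) - g (-s)) - s ^ k • (φ k - ψ k)) =O[𝓝[≠] 0]
          fun s => s ^ (k + 1) := by
        have := h1.comp_tendsto hneg
        simp only [Function.comp_def, hev.neg_pow] at this
        exact this.trans (IsBigO.of_norm_left (IsBigO.of_bound 1 (by simp)))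
      have hn : 1 ≤ n := by omega
      have h3 : (fun s => f s - 1) =O[𝓝[≠] 0] fun s : ℝ => s ^ 1 := by
        simpa [hf0] using (hf.truncate hτ hn).remainder
      have h4 : (fun s => g (-s) - 1) =O[𝓝[≠] 0] fun s : ℝ => s ^ 1 := by
        have := (hg.truncate hτ hn).remainder.comp_tendsto hneg
        simpa [hg0, Function.comp_def] using this.neg_right
      have hc : (fun s : ℝ => s ^ k • (φ k - ψ k)) =O[𝓝[≠] 0] fun s => s ^ k := by
        simpa using (isBigO_refl (fun s : ℝ => s ^ k) (𝓝[≠] 0)).smul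
          (isBigO_const_const (φ k - ψ k) (one_ne_zero (α := ℝ)) _)
      have hfb := hf.isBigO_one hτ
      have hgb : (fun s => g (-s)) =O[𝓝[≠] 0] fun _ : ℝ => (1 : ℝ) :=
        (hg.isBigO_one hτ).comp_tendsto hneg
      have t1 := h2.mul hfb
      have t2 := hgb.mul h1
      have t3 := hc.mul h3
      have t4 := h4.mul hc
      simp only [mul_one, one_mul, ← pow_add] at t1 t2 t3 t4
      simp only [add_comm 1 k] at t4
      have t5 := (((t1.add t2).add t3).add t4).const_smul_left (-(1 / 2 : ℝ))
      refine sub_eq_zero.1 (eq_zero_of_pow_smul_isBigO hτ self_mem_nhdsWithin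
        (t5.congr_left fun s => ?_))
      have e1 : (f (-s) - g (-s)) * f s + g (-s) * (f s - g s) = 0 := by
        rw [sub_mul, mul_sub, hfs, hgs]; abel
      set d := s ^ k • (φ k - ψ k)
      have e2 : (f (-s) - g (-s) - d) * f s + g (-s) * (f s - g s - d) + d * (f s - 1) +
          (g (-s) - 1) * d = ((f (-s) - g (-s)) * f s + g (-s) * (f s - g s)) - (2 : ℝ) • d := by
        rw [two_smul]; noncomm_ring
      simp only [Pi.smul_apply]
      rw [e2, e1, zero_sub, smul_neg, smul_smul]
      norm_num
      rfl
    · exact hodd k hk hod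

theorem exp_sub_sum_isBigO [CompleteSpace E] (n : ℕ) :
    (fun x : E => NormedSpace.exp x - ∑ k ∈ Finset.range n, (k.factorial : ℝ)⁻¹ • x ^ k)
      =O[𝓝 0] fun x => ‖x‖ ^ n := by
  have h := (NormedSpace.exp_hasFPowerSeriesAt_zero (𝕂 := ℝ)
    (𝔸 := E)).isBigO_sub_partialSum_pow n
  refine h.congr_left fun x => ?_
  simp [FormalMultilinearSeries.partialSum, NormedSpace.expSeries_apply_eq]

end Expansion

/-! ### Noncommutative word series graded by weight. -/

section Words

variable {α E : Type*} [NormedRing E] [NormedAlgebra ℝ E]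

/-- The part of weight `n` of the noncommutative series `∑_w c(w) a_w`, where the letter `k` has
weight `k + 1` and stands for `a k`. -/
def wordSum (a : ℕ → E) : ℕ → (List ℕ → ℝ) → E
  | 0, c => c [] • 1
  | n + 1, c => ∑ k : Fin (n + 1), a k * wordSum a (n - k) fun w => c (k :: w)

/-- The coefficients of the product of two noncommutative series. -/
def conv : (List ℕ → ℝ) → (List ℕ → ℝ) → List ℕ → ℝ
  | c, d, [] => c [] * d []
  | c, d, k :: w => c [] * d (k :: w) + conv (fun v => c (k :: v)) d w

/-- The coefficients of the series `∑_k ξ(k) a_k`. -/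
def letterSeries (ξ : ℕ → ℝ) : List ℕ → ℝ
  | [k] => ξ k
  | _ => 0

/-- The coefficients of the `n`-th power of the series `∑_k ξ(k) a_k`. -/
def powSeries (ξ : ℕ → ℝ) (n : ℕ) (w : List ℕ) : ℝ :=
  if w.length = n then (w.map ξ).prod else 0

/-- The coefficients of the exponential of the series `∑_k ξ(k) a_k`, up to words of length `6`. -/
noncomputable def expSeries (ξ : ℕ → ℝ) (w : List ℕ) : ℝ :=
  ∑ n ∈ Finset.range 7, (n.factorial : ℝ)⁻¹ * powSeries ξ n w

theorem wordSum_smul (a : ℕ → E) (n : ℕ) (r : ℝ) (c : List ℕ → ℝ) :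
    wordSum a n (fun w => r * c w) = r • wordSum a n c := by
  induction n using Nat.strong_induction_on generalizing c with
  | _ n ih =>
    rcases n with _ | n
    · simp [wordSum, mul_smul]
    · rw [wordSum, wordSum, Finset.smul_sum]
      refine Finset.sum_congr rfl fun k _ => ?_
      rw [ih _ (by omega), mul_smul_comm]

theorem wordSum_add (a : ℕ → E) (n : ℕ) (c d : List ℕ → ℝ) :
    wordSum a n (fun w => c w + d w) = wordSum a n c + wordSum a n d := by
  induction n using Nat.strong_induction_on generalizing c d with
  | _ n ih =>
    rcases n with _ | n
    · simp [wordSum, add_smul]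
    · rw [wordSum, wordSum, wordSum, ← Finset.sum_add_distrib]
      refine Finset.sum_congr rfl fun k _ => ?_
      rw [ih _ (by omega), mul_add]

theorem wordSum_zero (a : ℕ → E) (n : ℕ) : wordSum a n (fun _ => 0) = 0 := by
  simpa using wordSum_smul a n 0 fun _ => 0

theorem wordSum_finset_sum {ι : Type*} (s : Finset ι) (a : ℕ → E) (n : ℕ)
    (c : ι → List ℕ → ℝ) :
    wordSum a n (fun w => ∑ i ∈ s, c i w) = ∑ i ∈ s, wordSum a n (c i) := by
  classical
  induction s using Finset.induction_on with
  | empty => simpa using wordSum_zero a n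
  | insert i s hi ih => simp only [Finset.sum_insert hi, wordSum_add, ih]

/-- Cutting a word into a prefix and a suffix splits its weight additively, so `conv` is the Cauchy
product in each weight. The recursions of `wordSum` and `conv` both peel off the first letter, hence
the induction with `c` generalized. -/
theorem wordSum_conv (a : ℕ → E) (n : ℕ) (c d : List ℕ → ℝ) :
    wordSum a n (conv c d) =
      ∑ i ∈ Finset.range (n + 1), wordSum a i c * wordSum a (n - i) d := by
  induction n using Nat.strong_induction_on generalizing c with
  | _ n ih =>
    rcases n with _ | n
    · simp [wordSum, conv, smul_smul, mul_comm]
    · have h1 : ∀ k : Fin (n + 1), wordSum a (n - k) (fun w => conv c d (k :: w)) =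
          c [] • wordSum a (n - k) (fun w => d (k :: w)) +
          ∑ i ∈ Finset.range (n - k + 1),
            wordSum a i (fun v => c (k :: v)) * wordSum a (n - k - i) d := fun k => by
        rw [← ih _ (by omega), ← wordSum_smul, ← wordSum_add]
        rfl
      rw [wordSum, Finset.sum_range_succ']
      simp only [h1, mul_add, Finset.sum_add_distrib, mul_smul_comm]
      rw [← Finset.smul_sum, add_comm]
      congr 1
      · simp only [wordSum, Nat.add_sub_add_right, Fin.sum_univ_eq_sum_range
          (fun k => a k * ∑ i ∈ Finset.range (n - k + 1),
            wordSum a i (fun v => c (k :: v)) * wordSum a (n - k - i) d)]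
        have h2 : ∀ k ∈ Finset.range (n + 1), a k * ∑ i ∈ Finset.range (n - k + 1),
            wordSum a i (fun v => c (k :: v)) * wordSum a (n - k - i) d =
            ∑ i ∈ Finset.range (n + 1 - k), a k *
              (wordSum a i (fun v => c (k :: v)) * wordSum a (n - k - i) d) := fun k hk => by
          rw [Finset.mul_sum, Nat.sub_add_comm (by grind : k ≤ n)]
        rw [Finset.sum_congr rfl h2]
        rw [← Finset.sum_range_diag_flip (n + 1) fun k i => a k *
          (wordSum a i (fun v => c (k :: v)) * wordSum a (n - k - i) d)]
        refine Finset.sum_congr rfl fun m hm => ?_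
        rw [Fin.sum_univ_eq_sum_range
          (fun k => a k * wordSum a (m - k) fun w => c (k :: w)), Finset.sum_mul]
        refine Finset.sum_congr rfl fun k hk => ?_
        rw [mul_assoc, show n - k - (m - k) = n - m by grind]
      · simp [wordSum]

theorem conv_zero_left (d : List ℕ → ℝ) (w : List ℕ) : conv (fun _ => 0) d w = 0 := by
  induction w with
  | nil => simp [conv]
  | cons k w ih => simp [conv, ih]

theorem conv_letterSeries (ξ : ℕ → ℝ) (d : List ℕ → ℝ) (k : ℕ) (w : List ℕ) :
    conv (letterSeries ξ) d (k :: w) = ξ k * d w := by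
  have h : (fun v => letterSeries ξ (k :: v)) = fun v => if v = [] then ξ k else 0 := by
    funext v
    cases v <;> simp [letterSeries]
  rw [conv, h]
  cases w with
  | nil => simp [conv, letterSeries]
  | cons j w => simp [conv, letterSeries, conv_zero_left]

theorem conv_letterSeries_powSeries (ξ : ℕ → ℝ) (n : ℕ) :
    conv (letterSeries ξ) (powSeries ξ n) = powSeries ξ (n + 1) := by
  funext w
  cases w with
  | nil => simp [conv, letterSeries, powSeries]
  | cons k w => rw [conv_letterSeries]; simp [powSeries]

theorem wordSum_powSeries_zero (a : ℕ → E) (ξ : ℕ → ℝ) (n : ℕ) :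
    wordSum a n (powSeries ξ 0) = if n = 0 then 1 else 0 := by
  rcases n with _ | n
  · simp [wordSum, powSeries]
  · rw [wordSum, Finset.sum_eq_zero]
    · simp
    · intro k _
      have : (fun w => powSeries ξ 0 ((k : ℕ) :: w)) = fun _ => 0 := by
        funext w; simp [powSeries]
      rw [this, wordSum_zero, mul_zero]

theorem wordSum_letterSeries_zero (a : ℕ → E) (ξ : ℕ → ℝ) :
    wordSum a 0 (letterSeries ξ) = 0 := by
  simp [wordSum, letterSeries]

theorem wordSum_letterSeries_succ (a : ℕ → E) (ξ : ℕ → ℝ) (n : ℕ) :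
    wordSum a (n + 1) (letterSeries ξ) = ξ n • a n := by
  have h : ∀ k : ℕ, (fun w => letterSeries ξ (k :: w)) = fun w => ξ k * powSeries ξ 0 w := by
    intro k
    funext v
    cases v <;> simp [letterSeries, powSeries]
  simp only [wordSum, h, wordSum_smul, wordSum_powSeries_zero]
  rw [Finset.sum_eq_single (Fin.last n)]
  · simp
  · intro k _ hk
    have : n - (k : ℕ) ≠ 0 := by
      have := Fin.val_lt_last hk
      omega
    simp [this]
  · simp

theorem expSeries_of_length_lt (ξ : ℕ → ℝ) {w : List ℕ} (hw : w.length < 7) :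
    expSeries ξ w = (w.length.factorial : ℝ)⁻¹ * (w.map ξ).prod := by
  rw [expSeries, Finset.sum_eq_single w.length]
  · simp [powSeries]
  · intro n _ hn
    simp [powSeries, Ne.symm hn]
  · simp [hw]

variable {l : Filter α} {τ : α → ℝ} {n : ℕ} {a : ℕ → α → E}

/-- `f = ∑_w c(w) a_w τ^|w| + O(τ^n)`, where the sum extends over the words of weight `|w| < n`. -/
abbrev IsWordExpansion (l : Filter α) (τ : α → ℝ) (a : ℕ → α → E) (n : ℕ) (f : α → E)
    (c : List ℕ → ℝ) : Prop :=
  IsExpansion l τ n f fun k p => wordSum (fun j => a j p) k c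

theorem IsWordExpansion.mul (hτ : Tendsto τ l (𝓝 0)) {f g : α → E} {c d : List ℕ → ℝ}
    (hf : IsWordExpansion l τ a n f c) (hg : IsWordExpansion l τ a n g d) :
    IsWordExpansion l τ a n (fun p => f p * g p) (conv c d) :=
  (IsExpansion.mul hτ hf hg).congr_coeff fun _ _ _ => (wordSum_conv _ _ _ _).symm

theorem IsWordExpansion.pow (hτ : Tendsto τ l (𝓝 0)) {f : α → E} {ξ : ℕ → ℝ}
    (hf : IsWordExpansion l τ a n f (letterSeries ξ)) (m : ℕ) :
    IsWordExpansion l τ a n (fun p => f p ^ m) (powSeries ξ m) := by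
  induction m with
  | zero =>
    simp only [pow_zero]
    exact IsExpansion.one.congr_coeff fun _ _ _ => (wordSum_powSeries_zero _ _ _).symm
  | succ m ih =>
    simp only [pow_succ']
    rw [← conv_letterSeries_powSeries]
    exact hf.mul hτ ih

theorem IsWordExpansion.exp [CompleteSpace E] (hτ : Tendsto τ l (𝓝 0)) {f : α → E} {ξ : ℕ → ℝ}
    (hf : IsWordExpansion l τ a 7 f (letterSeries ξ)) :
    IsWordExpansion l τ a 7 (fun p => NormedSpace.exp (f p)) (expSeries ξ) := by
  have h1 : IsWordExpansion l τ a 7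
      (fun p => ∑ k ∈ Finset.range 7, (k.factorial : ℝ)⁻¹ • f p ^ k) (expSeries ξ) := by
    refine (IsExpansion.sum (Finset.range 7) fun k _ =>
      (hf.pow hτ k).const_smul (k.factorial : ℝ)⁻¹).congr_coeff fun k _ p => ?_
    simp only [← wordSum_smul, ← wordSum_finset_sum]
    rfl
  -- Every letter has positive weight, so the exponent is O(τ) and cutting the exponential series
  -- after the sixth power costs only O(τ^7).
  have h2 : f =O[l] τ := by
    simpa [wordSum_letterSeries_zero] using (hf.truncate hτ (by norm_num : 1 ≤ 7)).remainder
  have h3 := ((exp_sub_sum_isBigO (E := E) 7).comp_tendsto (h2.trans_tendsto hτ)).trans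
    (h2.norm_left.pow 7)
  exact (h1.add_isBigO h3).congr_left fun p => by simp

end Words

/-! ### Taylor expansion with remainder uniform in the base point. -/

section Taylor

variable {E : Type*} [NormedAddCommGroup E] [NormedSpace ℝ E] {K : Set ℝ}

/-- This filter encodes uniformity: estimates along it hold for all base points in K with one common
radius for the step. -/
theorem eventually_principal_prod_nhds_zero {P : ℝ × ℝ → Prop} :
    (∀ᶠ p in 𝓟 K ×ˢ 𝓝 (0 : ℝ), P p) ↔ ∃ ε > 0, ∀ m ∈ K, ∀ s, |s| < ε → P (m, s) := by
  have h := ((hasBasis_principal K).prod (Metric.nhds_basis_ball (x := (0 : ℝ)))).eventually_iff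
    (q := P)
  simp only [true_and, Set.mem_prod, Metric.mem_ball, dist_zero_right, Real.norm_eq_abs,
    Prod.forall, Prod.exists, exists_const] at h
  rw [h]
  exact ⟨fun ⟨ε, h1, h2⟩ => ⟨ε, h1, fun m hm s hs => h2 m s ⟨hm, hs⟩⟩,
    fun ⟨ε, h1, h2⟩ => ⟨ε, h1, fun m s hp => h2 m hp.1 s hp.2⟩⟩

/-- By the mean value inequality, integrating from 0 gains one power of s. This drives both the
Taylor estimate and the expansion of the propagator. -/
theorem isBigO_of_hasDerivAt {f f' : ℝ → ℝ → E} (hf : ∀ m s, HasDerivAt (f m) (f' m s) s)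
    (h0 : ∀ m, f m 0 = 0) {n : ℕ}
    (h : (fun p : ℝ × ℝ => f' p.1 p.2) =O[𝓟 K ×ˢ 𝓝 (0 : ℝ)] fun p => p.2 ^ n) :
    (fun p : ℝ × ℝ => f p.1 p.2) =O[𝓟 K ×ˢ 𝓝 (0 : ℝ)] fun p => p.2 ^ (n + 1) := by
  obtain ⟨C, hC⟩ := h.bound
  obtain ⟨ε, hε, hb⟩ := eventually_principal_prod_nhds_zero.1 hC
  refine IsBigO.of_bound C (eventually_principal_prod_nhds_zero.2 ⟨ε, hε, fun m hm s hs => ?_⟩)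
  have hC0 : 0 ≤ C * |s| ^ n := by
    have := (norm_nonneg _).trans (hb m hm s hs)
    simpa using this
  have key : ∀ r ∈ Set.uIcc 0 s, ‖f' m r‖ ≤ C * |s| ^ n := by
    intro r hr
    have h1 : |r| ≤ |s| := by
      rcases Set.mem_uIcc.1 hr with h | h
      · rw [abs_of_nonneg h.1, abs_of_nonneg (h.1.trans h.2)]; exact h.2
      · rw [abs_of_nonpos h.2, abs_of_nonpos (h.1.trans h.2)]; linarith [h.1]
    have h2 := hb m hm r (h1.trans_lt hs)
    simp only [norm_pow, Real.norm_eq_abs] at h2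
    rcases le_or_gt 0 C with hC | hC
    · exact h2.trans (by gcongr)
    -- The constant from `IsBigO` may be negative; the bound then forces |s|^n = 0.
    · have h3 : |s| ^ n = 0 := by
        by_contra h3
        have : 0 < |s| ^ n := lt_of_le_of_ne (by positivity) (Ne.symm h3)
        nlinarith
      rw [h3, mul_zero]
      exact h2.trans (mul_nonpos_of_nonpos_of_nonneg hC.le (by positivity))
  have := (convex_uIcc (0 : ℝ) s).norm_image_sub_le_of_norm_hasDerivWithin_le
    (fun r _ => (hf m r).hasDerivWithinAt) key Set.left_mem_uIcc Set.right_mem_uIcc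
  simpa [h0, pow_succ, mul_assoc] using this

/-- The Taylor coefficient `f^(k)(m) / k!`. -/
noncomputable def taylorCoeff (f : ℝ → E) (k : ℕ) (m : ℝ) : E :=
  (k.factorial : ℝ)⁻¹ • iteratedDeriv k f m

theorem isBigO_one_of_continuous {G : Type*} [NormedAddCommGroup G] (hK : IsCompact K)
    {f : ℝ × ℝ → G} (hf : Continuous f) :
    f =O[𝓟 K ×ˢ 𝓝 (0 : ℝ)] fun _ => (1 : ℝ) := by
  obtain ⟨C, hC⟩ := (hK.prod (isCompact_Icc (a := (-1 : ℝ)) (b := 1))).exists_bound_of_continuousOn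
    hf.continuousOn
  refine IsBigO.of_bound C (eventually_principal_prod_nhds_zero.2
    ⟨1, one_pos, fun m hm s hs => ?_⟩)
  simpa using hC (m, s) ⟨hm, (abs_lt.1 hs).1.le, (abs_lt.1 hs).2.le⟩

theorem taylor_isBigO (hK : IsCompact K) {n : ℕ} {f : ℝ → E} (hf : ContDiff ℝ n f) :
    (fun p : ℝ × ℝ => f (p.1 + p.2) - ∑ k ∈ Finset.range n, p.2 ^ k • taylorCoeff f k p.1)
      =O[𝓟 K ×ˢ 𝓝 (0 : ℝ)] fun p => p.2 ^ n := by
  induction n generalizing f with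
  | zero =>
    have hc : Continuous f := hf.continuous
    simpa using isBigO_one_of_continuous hK (hc.comp (continuous_fst.add continuous_snd))
  | succ n ih =>
    have hf' : ContDiff ℝ ((n : WithTop ℕ∞) + 1) f := by exact_mod_cast hf
    have hd : ContDiff ℝ n (deriv f) := (contDiff_succ_iff_deriv.1 hf').2.2
    have hdf : Differentiable ℝ f := (contDiff_succ_iff_deriv.1 hf').1
    refine isBigO_of_hasDerivAt (f := fun m s =>
      f (m + s) - ∑ k ∈ Finset.range (n + 1), s ^ k • taylorCoeff f k m) (f' := fun m s =>
      deriv f (m + s) - ∑ k ∈ Finset.range n, s ^ k • taylorCoeff (deriv f) k m) ?_ ?_ (ih hd)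
    · intro m s
      refine HasDerivAt.sub ?_ ?_
      · simpa [Function.comp_def] using (hdf (m + s)).hasDerivAt.scomp s ((hasDerivAt_id s).const_add m)
      · simp only [Finset.sum_range_succ', pow_zero]
        refine HasDerivAt.add_const _ (HasDerivAt.fun_sum fun k _ => ?_)
        have := (hasDerivAt_pow (k + 1) s).smul_const (taylorCoeff f (k + 1) m)
        refine this.congr_deriv ?_
        rw [taylorCoeff, taylorCoeff, iteratedDeriv_succ', smul_smul, smul_smul, Nat.factorial_succ]
        congr 1
        push_cast
        field_simp
    · intro m
      simp [Finset.sum_range_succ', taylorCoeff]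

end Taylor

/-! ### Expansion of the midpoint differential equation. -/

section Midpoint

variable {E : Type*} [NormedRing E] [NormedAlgebra ℝ E] {K : Set ℝ}

theorem tendsto_snd_principal_prod : Tendsto (Prod.snd : ℝ × ℝ → ℝ) (𝓟 K ×ˢ 𝓝 0) (𝓝 0) :=
  tendsto_snd

theorem isExpansion_taylor (hK : IsCompact K) {n : ℕ} {f : ℝ → E} (hf : ContDiff ℝ n f) (c : ℝ) :
    IsExpansion (𝓟 K ×ˢ 𝓝 (0 : ℝ)) Prod.snd n (fun p => f (p.1 + c * p.2))
      fun k p => c ^ k • taylorCoeff f k p.1 := by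
  constructor
  · intro k hk
    refine isBigO_one_of_continuous hK ?_
    have : Continuous (iteratedDeriv k f) :=
      hf.continuous_iteratedDeriv k (by exact_mod_cast hk.le)
    unfold taylorCoeff
    fun_prop
  · have ht : Tendsto (fun p : ℝ × ℝ => (p.1, c * p.2)) (𝓟 K ×ˢ 𝓝 0) (𝓟 K ×ˢ 𝓝 0) := by
      refine tendsto_fst.prodMk ?_
      simpa using (tendsto_snd_principal_prod (K := K)).const_mul c
    refine ((taylor_isBigO hK hf).comp_tendsto ht).trans ?_ |>.congr_left fun p => ?_
    · simp only [Function.comp_def, mul_pow]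
      exact (isBigO_refl _ _).const_mul_left _
    · simp only [Function.comp_def, mul_pow, smul_smul]
      simp only [mul_comm]

/-- The Taylor coefficients at `0` of the solution of
`Y'(s) = (A(s / 2) Y(s) + Y(s) A(-s / 2)) / 2`, `Y(0) = 1`, where `A(s) = ∑_k a_k s^k`. -/
noncomputable def midCoeff (a : ℕ → E) : ℕ → E
  | 0 => 1
  | k + 1 => ((k : ℝ) + 1)⁻¹ • (1 / 2 : ℝ) •
      ((∑ i : Fin (k + 1), ((1 / 2 : ℝ) ^ (i : ℕ) • a i) * midCoeff a (k - i)) +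
        ∑ i : Fin (k + 1), midCoeff a i * ((-1 / 2 : ℝ) ^ (k - i : ℕ) • a (k - i)))

theorem midCoeff_succ (a : ℕ → E) (k : ℕ) : midCoeff a (k + 1) = ((k : ℝ) + 1)⁻¹ • (1 / 2 : ℝ) •
    ((∑ i ∈ Finset.range (k + 1), ((1 / 2 : ℝ) ^ i • a i) * midCoeff a (k - i)) +
      ∑ i ∈ Finset.range (k + 1), midCoeff a i * ((-1 / 2 : ℝ) ^ (k - i) • a (k - i))) := by
  rw [midCoeff, Fin.sum_univ_eq_sum_range
    (fun i => ((1 / 2 : ℝ) ^ i • a i) * midCoeff a (k - i)), Fin.sum_univ_eq_sum_range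
    (fun i => midCoeff a i * ((-1 / 2 : ℝ) ^ (k - i) • a (k - i)))]

/-- A bootstrap as in Picard iteration: an expansion of Y to order n gives one of the right-hand
side to order n, and integration then gives Y to order n + 1. Boundedness of Y starts the induction.
The final integration is why an A of class C^N suffices for order N + 1. -/
theorem isExpansion_of_hasDerivAt (hK : IsCompact K) {N : ℕ} {A : ℝ → E} (hA : ContDiff ℝ N A)
    {Y : ℝ → ℝ → E} (hY0 : ∀ m, Y m 0 = 1)
    (hY : ∀ m s, HasDerivAt (Y m) ((1 / 2 : ℝ) •
      (A (m + 1 / 2 * s) * Y m s + Y m s * A (m + -1 / 2 * s))) s)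
    (hb : (fun p : ℝ × ℝ => Y p.1 p.2) =O[𝓟 K ×ˢ 𝓝 (0 : ℝ)] fun _ => (1 : ℝ)) {n : ℕ}
    (hn : n ≤ N + 1) :
    IsExpansion (𝓟 K ×ˢ 𝓝 (0 : ℝ)) Prod.snd n (fun p => Y p.1 p.2)
      fun k p => midCoeff (fun j => taylorCoeff A j p.1) k := by
  induction n with
  | zero => exact ⟨by simp, by simpa using hb⟩
  | succ n ih =>
    have ih := ih (by omega)
    have hAn : ContDiff ℝ n A := hA.of_le (by exact_mod_cast (by omega : n ≤ N))
    have h3 := (((isExpansion_taylor hK hAn (1 / 2)).mul tendsto_snd_principal_prod ih).add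
      (ih.mul tendsto_snd_principal_prod (isExpansion_taylor hK hAn (-1 / 2)))).const_smul (1 / 2)
    constructor
    · intro k hk
      rcases k with _ | k
      · simpa [midCoeff] using isBigO_const_const (1 : E) (one_ne_zero (α := ℝ)) _
      · have := (h3.coeff k (by omega)).const_smul_left ((k : ℝ) + 1)⁻¹
        refine this.congr_left fun p => ?_
        rw [midCoeff_succ]
        rfl
    · refine isBigO_of_hasDerivAt (f := fun m s => Y m s - ∑ k ∈ Finset.range (n + 1),
        s ^ k • midCoeff (fun j => taylorCoeff A j m) k) (f' := fun m s => (1 / 2 : ℝ) •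
        (A (m + 1 / 2 * s) * Y m s + Y m s * A (m + -1 / 2 * s)) -
        ∑ k ∈ Finset.range n, s ^ k • (1 / 2 : ℝ) •
          ((∑ i ∈ Finset.range (k + 1), ((1 / 2 : ℝ) ^ i • taylorCoeff A i m) *
            midCoeff (fun j => taylorCoeff A j m) (k - i)) +
          ∑ i ∈ Finset.range (k + 1), midCoeff (fun j => taylorCoeff A j m) i *
            ((-1 / 2 : ℝ) ^ (k - i) • taylorCoeff A (k - i) m))) ?_ ?_ h3.remainder
      · intro m s
        refine (hY m s).sub ?_
        simp only [Finset.sum_range_succ' _ n, pow_zero]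
        refine HasDerivAt.add_const _ (HasDerivAt.fun_sum fun k _ => ?_)
        have := (hasDerivAt_pow (k + 1) s).smul_const
          (midCoeff (fun j => taylorCoeff A j m) (k + 1))
        refine this.congr_deriv ?_
        rw [midCoeff_succ, smul_smul]
        congr 1
        push_cast
        field_simp
      · intro m
        simp [Finset.sum_range_succ', midCoeff, hY0]

end Midpoint

/-! ### Unitarity and time symmetry of the exact propagator. -/

section Propagator

open scoped Matrix.Norms.L2Operator

variable {N : ℕ} {H : ℝ → Matrix (Fin N) (Fin N) ℂ} {U : ℝ → ℝ → Matrix (Fin N) (Fin N) ℂ}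

theorem hamiltonian_isHermitian {T : Matrix (Fin N) (Fin N) ℂ} (hT : T.IsHermitian)
    (V : ℝ → Fin N → ℝ) (t : ℝ) : (hamiltonian T V t).IsHermitian := by
  refine hT.add ?_
  rw [potential, Matrix.isHermitian_diagonal_iff]
  intro k
  simp [isSelfAdjoint_iff]

/-- Since H is Hermitian, the derivative in r of the left-hand side vanishes; its value at r = t is
the right-hand side. Unitarity and the composition law both follow. -/
theorem IsPropagator.star_mul (hU : IsPropagator H U) (hH : ∀ t, (H t).IsHermitian)
    (r s t : ℝ) : star (U r s) * U r t = star (U t s) := by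
  have hd : ∀ r, HasDerivAt (fun r => star (U r s) * U r t) 0 r := by
    intro r
    refine (((hU s).2 r).star.mul ((hU t).2 r)).congr_deriv ?_
    have : star (H r) = H r := hH r
    simp only [star_smul, StarMul.star_mul, this, star_neg, RCLike.star_def, Complex.conj_I,
      smul_mul_assoc, mul_smul_comm, neg_neg, neg_smul, mul_neg, mul_assoc, add_neg_cancel]
  have h := is_const_of_deriv_eq_zero (fun r => (hd r).differentiableAt)
    (fun r => (hd r).deriv) r t
  simpa [(hU t).1] using h

theorem IsPropagator.star_mul_self (hU : IsPropagator H U) (hH : ∀ t, (H t).IsHermitian)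
    (r s : ℝ) : star (U r s) * U r s = 1 := by
  rw [hU.star_mul hH, (hU s).1, star_one]

theorem IsPropagator.eq_mul_star (hU : IsPropagator H U) (hH : ∀ t, (H t).IsHermitian)
    (r s t : ℝ) : U r t = U r s * star (U t s) := by
  rw [← hU.star_mul hH r s t, ← mul_assoc, mul_eq_one_comm.1 (hU.star_mul_self hH r s), one_mul]

/-- The propagator over the interval of length `s` with midpoint `m`. -/
noncomputable def midPropagator (U : ℝ → ℝ → Matrix (Fin N) (Fin N) ℂ) (m s : ℝ) :
    Matrix (Fin N) (Fin N) ℂ :=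
  U (m + 1 / 2 * s) (m + -1 / 2 * s)

theorem IsPropagator.midPropagator_zero (hU : IsPropagator H U) (m : ℝ) :
    midPropagator U m 0 = 1 := by
  simp [midPropagator, (hU m).1]

theorem IsPropagator.midPropagator_neg_mul (hU : IsPropagator H U)
    (hH : ∀ t, (H t).IsHermitian) (m s : ℝ) :
    midPropagator U m (-s) * midPropagator U m s = 1 := by
  have e1 : m + 1 / 2 * -s = m + -1 / 2 * s := by ring
  have e2 : m + -1 / 2 * -s = m + 1 / 2 * s := by ring
  rw [midPropagator, midPropagator, e1, e2, hU.eq_mul_star hH _ m (m + 1 / 2 * s),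
    hU.eq_mul_star hH _ m (m + -1 / 2 * s)]
  have h1 := hU.star_mul_self hH (m + 1 / 2 * s) m
  have h2 := mul_eq_one_comm.1 (hU.star_mul_self hH (m + -1 / 2 * s) m)
  rw [mul_assoc, ← mul_assoc (star _) (U _ _), h1, one_mul, h2]

/-- `IsPropagator` gives a derivative only in the final time. Factoring through the fixed time m
turns dependence on the initial time into the adjoint of dependence on a final time. -/
theorem IsPropagator.hasDerivAt_midPropagator (hU : IsPropagator H U)
    (hH : ∀ t, (H t).IsHermitian) (m s : ℝ) :
    HasDerivAt (midPropagator U m) ((1 / 2 : ℝ) •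
      ((-Complex.I • H (m + 1 / 2 * s)) * midPropagator U m s +
        midPropagator U m s * (-Complex.I • H (m + -1 / 2 * s)))) s := by
  have hfun : midPropagator U m = fun s => U (m + 1 / 2 * s) m * star (U (m + -1 / 2 * s) m) := by
    funext s
    exact hU.eq_mul_star hH _ _ _
  have hlin : ∀ c : ℝ, HasDerivAt (fun s => U (m + c * s) m)
      (c • (-Complex.I • (H (m + c * s) * U (m + c * s) m))) s := by
    intro c
    have h1 : HasDerivAt (fun s : ℝ => m + c * s) c s := by
      simpa using ((hasDerivAt_id s).const_mul c).const_add m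
    exact ((hU m).2 (m + c * s)).scomp s h1
  rw [hfun]
  refine ((hlin (1 / 2)).mul (hlin (-1 / 2)).star).congr_deriv ?_
  have : star (H (m + -1 / 2 * s)) = H (m + -1 / 2 * s) := hH _
  simp only [star_smul, StarMul.star_mul, this, star_neg, RCLike.star_def, Complex.conj_I,
    smul_mul_assoc, mul_smul_comm, neg_neg, neg_smul, mul_neg, neg_mul, mul_assoc, star_trivial,
    smul_add, smul_neg]
  congr 1
  rw [← neg_smul]
  norm_num

theorem IsPropagator.norm_midPropagator_sq (hU : IsPropagator H U)
    (hH : ∀ t, (H t).IsHermitian) (m s : ℝ) :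
    ‖midPropagator U m s‖ * ‖midPropagator U m s‖ = ‖(1 : Matrix (Fin N) (Fin N) ℂ)‖ := by
  rw [← CStarRing.norm_star_mul_self, midPropagator, hU.star_mul_self hH]

theorem IsPropagator.isExpansion_midPropagator (hU : IsPropagator H U)
    (hH : ∀ t, (H t).IsHermitian) {K : Set ℝ} (hK : IsCompact K) {n : ℕ}
    (hs : ContDiff ℝ n fun t => -Complex.I • H t) :
    IsExpansion (𝓟 K ×ˢ 𝓝 (0 : ℝ)) Prod.snd (n + 1) (fun p => midPropagator U p.1 p.2)
      fun k p => midCoeff (fun j => taylorCoeff (fun t => -Complex.I • H t) j p.1) k := by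
  refine isExpansion_of_hasDerivAt hK hs hU.midPropagator_zero
    (hU.hasDerivAt_midPropagator hH) ?_ le_rfl
  -- The norm of the identity is 0 when N = 0, so it is kept as it is; y² = ‖1‖ implies y ≤ 1 + ‖1‖.
  refine IsBigO.of_bound (1 + ‖(1 : Matrix (Fin N) (Fin N) ℂ)‖) (Eventually.of_forall fun p => ?_)
  have h1 := hU.norm_midPropagator_sq hH p.1 p.2
  have h2 := norm_nonneg (midPropagator U p.1 p.2)
  rw [norm_one (α := ℝ), mul_one]
  nlinarith

end Propagator

/-! ### Expansion of the composition, and order six as equality of coefficients. -/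

section Composition

open scoped Matrix.Norms.L2Operator

/-- The coefficients of the Taylor coefficients of `A` in an exponent `∑ⱼ xⱼ αⱼ`, up to order `6`. -/
noncomputable def letterCoeff (x : Fin 3 → ℝ) : ℕ → ℝ
  | 0 => x 0
  | 1 => x 1
  | 2 => x 2
  | 3 => 3 / 20 * x 1
  | 4 => 3 / 20 * x 2
  | 5 => 9 / 400 * x 1
  | _ => 0

/-- The word coefficients of a five-exponential composition. -/
noncomputable def compSeries (x : Matrix (Fin 5) (Fin 3) ℝ) : List ℕ → ℝ :=
  conv (conv (conv (conv (expSeries (letterCoeff (x 4))) (expSeries (letterCoeff (x 3))))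
    (expSeries (letterCoeff (x 2)))) (expSeries (letterCoeff (x 1)))) (expSeries (letterCoeff (x 0)))

/-- The factor τ in front of the exponent shifts every coefficient by one and improves the remainder
by one order, so a potential of class C^6 reaches O(τ^7). -/
theorem IsExpansion.self_smul {α E : Type*} [NormedRing E] [NormedAlgebra ℝ E] {l : Filter α}
    {τ : α → ℝ} {n : ℕ} {f : α → E} {φ ψ : ℕ → α → E} (h : IsExpansion l τ n f φ)
    (h0 : ∀ p, ψ 0 p = 0) (hs : ∀ k < n, ∀ p, ψ (k + 1) p = φ k p) :
    IsExpansion l τ (n + 1) (fun p => τ p • f p) ψ := by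
  constructor
  · rintro (_ | k) hk
    · exact (isBigO_zero _ _).congr_left fun p => (h0 p).symm
    · exact (h.coeff k (by omega)).congr_left fun p => (hs k (by omega) p).symm
  · refine ((isBigO_refl τ l).smul h.remainder).congr (fun p => ?_) fun p => ?_
    · rw [Finset.sum_range_succ', h0, smul_zero, add_zero, smul_sub, Finset.smul_sum]
      congr 1
      refine Finset.sum_congr rfl fun k hk => ?_
      rw [hs k (Finset.mem_range.1 hk), smul_smul, pow_succ']
    · rw [smul_eq_mul, pow_succ']

section Exponent

variable {E : Type*} [NormedRing E] [NormedAlgebra ℝ E]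

/-- The exponent `∑ⱼ xⱼ αⱼ` for a step of size `s` with midpoint `m`. -/
noncomputable def midExponent (A : ℝ → E) (x : Fin 3 → ℝ) (m s : ℝ) : E :=
  s • (x 0 • A (m + 0 * s) + (x 1 * (√15 / 3)) • (A (m + √15 / 10 * s) - A (m + -(√15 / 10) * s)) +
    (x 2 * (10 / 3)) • (A (m + √15 / 10 * s) - (2 : ℝ) • A (m + 0 * s) +
      A (m + -(√15 / 10) * s)))

/-- About the midpoint the nodes lie at 0 and ±(√15/10)s. Hence the combination α₂ keeps only odd
Taylor coefficients and α₃ only even ones of positive index. Successive coefficients differ by the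
factor (√15/10)² = 3/20, which is the source of the numbers in `letterCoeff`. -/
theorem isWordExpansion_midExponent {K : Set ℝ} (hK : IsCompact K) {A : ℝ → E}
    (hA : ContDiff ℝ 6 A) (x : Fin 3 → ℝ) :
    IsWordExpansion (𝓟 K ×ˢ 𝓝 (0 : ℝ)) Prod.snd (fun j p => taylorCoeff A j p.1) 7
      (fun p => midExponent A x p.1 p.2) (letterSeries (letterCoeff x)) := by
  have hA' : ContDiff ℝ (6 : ℕ) A := hA
  have e := fun c => isExpansion_taylor hK hA' c
  have h := (((e 0).const_smul (x 0)).add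
    (((e (√15 / 10)).sub (e (-(√15 / 10)))).const_smul (x 1 * (√15 / 3)))).add
    ((((e (√15 / 10)).sub ((e 0).const_smul 2)).add (e (-(√15 / 10)))).const_smul (x 2 * (10 / 3)))
  refine h.self_smul (fun p => wordSum_letterSeries_zero _ _) fun k hk p => ?_
  rw [wordSum_letterSeries_succ]
  have h15 : √15 ^ 2 = 15 := Real.sq_sqrt (by norm_num)
  have h4 : √15 ^ 4 = 15 ^ 2 := by rw [show √15 ^ 4 = (√15 ^ 2) ^ 2 by ring, h15]
  have h6 : √15 ^ 6 = 15 ^ 3 := by rw [show √15 ^ 6 = (√15 ^ 2) ^ 3 by ring, h15]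
  have key : letterCoeff x k = x 0 * 0 ^ k +
      x 1 * (√15 / 3) * ((√15 / 10) ^ k - (-(√15 / 10)) ^ k) +
      x 2 * (10 / 3) * ((√15 / 10) ^ k - 2 * 0 ^ k + (-(√15 / 10)) ^ k) := by
    interval_cases k <;> simp only [letterCoeff] <;> ring_nf <;> (try simp only [h15, h4, h6]) <;>
      ring
  rw [key]
  module

/-- Reversing s exchanges the outer nodes, so α₁ and α₃ change sign and α₂ does not; the sign
pattern of time symmetry makes the whole exponent odd. -/
theorem midExponent_neg (A : ℝ → E) {x y : Fin 3 → ℝ} (h : ∀ j : Fin 3, y j = (-1) ^ (j : ℕ) * x j)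
    (m s : ℝ) : midExponent A y m (-s) = -midExponent A x m s := by
  have e1 : m + √15 / 10 * -s = m + -(√15 / 10) * s := by ring
  have e2 : m + -(√15 / 10) * -s = m + √15 / 10 * s := by ring
  simp only [midExponent, h, e1, e2, zero_mul]
  simp only [Fin.isValue, Fin.val_zero, Fin.val_one, Fin.val_two, pow_zero, pow_one]
  module

end Exponent

variable {N : ℕ}

theorem potential_add (v w : Fin N → ℝ) : potential (v + w) = potential v + potential w := by
  simp [potential]

theorem potential_smul (c : ℝ) (v : Fin N → ℝ) : potential (c • v) = c • potential v := by
  ext i j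
  by_cases h : i = j <;> simp [potential, h]

/-- `potential` as a continuous linear map. -/
noncomputable def potentialCLM (N : ℕ) : (Fin N → ℝ) →L[ℝ] Matrix (Fin N) (Fin N) ℂ :=
  LinearMap.toContinuousLinearMap
    { toFun := potential
      map_add' := potential_add
      map_smul' := potential_smul }

theorem contDiff_hamiltonian (T : Matrix (Fin N) (Fin N) ℂ) {V : ℝ → Fin N → ℝ} {n : WithTop ℕ∞}
    (hV : ContDiff ℝ n V) : ContDiff ℝ n fun t => -Complex.I • hamiltonian T V t := by
  have h : ContDiff ℝ n fun t => potential (V t) := (potentialCLM N).contDiff.comp hV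
  exact (contDiff_const.add h).const_smul (-Complex.I)

/-- The composition for a step of size `s` with midpoint `m`. -/
noncomputable def midComposition (x : Matrix (Fin 5) (Fin 3) ℝ) (T : Matrix (Fin N) (Fin N) ℂ)
    (V : ℝ → Fin N → ℝ) (m s : ℝ) : Matrix (Fin N) (Fin N) ℂ :=
  composition x N T V (m + -1 / 2 * s) s

theorem smul_sum_alpha (x : Fin 3 → ℝ) (T : Matrix (Fin N) (Fin N) ℂ) (V : ℝ → Fin N → ℝ)
    (m s : ℝ) : -Complex.I • ∑ j, (x j : ℂ) • alpha T V (m + -1 / 2 * s) s j =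
      midExponent (fun t => -Complex.I • hamiltonian T V t) x m s := by
  have e0 : m + -1 / 2 * s + node 0 * s = m + -(√15 / 10) * s := by simp [node]; ring
  have e1 : m + -1 / 2 * s + node 1 * s = m + 0 * s := by simp [node]; ring
  have e2 : m + -1 / 2 * s + node 2 * s = m + √15 / 10 * s := by simp [node]; ring
  simp only [Fin.sum_univ_three, alpha, nodePotential, e0, e1, e2, midExponent, hamiltonian,
    Matrix.cons_val_zero, Matrix.cons_val_one, Matrix.cons_val, Fin.isValue,
    ← Complex.coe_smul, smul_smul]
  push_cast
  module

theorem midComposition_eq (x : Matrix (Fin 5) (Fin 3) ℝ) (T : Matrix (Fin N) (Fin N) ℂ)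
    (V : ℝ → Fin N → ℝ) (m s : ℝ) : midComposition x T V m s =
      let E := fun i => NormedSpace.exp
        (midExponent (fun t => -Complex.I • hamiltonian T V t) (x i) m s)
      E 4 * E 3 * E 2 * E 1 * E 0 := by
  simp only [midComposition, composition, smul_sum_alpha]

theorem isWordExpansion_midComposition (x : Matrix (Fin 5) (Fin 3) ℝ)
    (T : Matrix (Fin N) (Fin N) ℂ) {V : ℝ → Fin N → ℝ} (hV : ContDiff ℝ 6 V) {K : Set ℝ}
    (hK : IsCompact K) :
    IsWordExpansion (𝓟 K ×ˢ 𝓝 (0 : ℝ)) Prod.snd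
      (fun j p => taylorCoeff (fun t => -Complex.I • hamiltonian T V t) j p.1) 7
      (fun p => midComposition x T V p.1 p.2) (compSeries x) := by
  have hτ := tendsto_snd_principal_prod (K := K)
  have h := fun i => (isWordExpansion_midExponent hK (contDiff_hamiltonian T hV) (x i)).exp hτ
  refine (((((h 4).mul hτ (h 3)).mul hτ (h 2)).mul hτ (h 1)).mul hτ (h 0)).congr_left fun p => ?_
  rw [midComposition_eq]

/-- At the interface of the two products the factor i of the step s meets the factor 5 - i + 1 of
the step -s, counted from 1. Their exponents are opposite, so the product collapses from the inside
outwards. -/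
theorem midComposition_neg_mul {x : Matrix (Fin 5) (Fin 3) ℝ} (hx : IsAdmissible x)
    (T : Matrix (Fin N) (Fin N) ℂ) (V : ℝ → Fin N → ℝ) (m s : ℝ) :
    midComposition x T V m (-s) * midComposition x T V m s = 1 := by
  rw [midComposition_eq, midComposition_eq]
  let _ : NormedAlgebra ℚ (Matrix (Fin N) (Fin N) ℂ) := NormedAlgebra.restrictScalars ℚ ℝ _
  have h : ∀ i : Fin 5, ∀ M, NormedSpace.exp (midExponent
      (fun t => -Complex.I • hamiltonian T V t) (x i.rev) m (-s)) * (NormedSpace.exp (midExponent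
      (fun t => -Complex.I • hamiltonian T V t) (x i) m s) * M) = M := fun i M => by
    rw [midExponent_neg _ (hx.1 i), ← mul_assoc, ← NormedSpace.exp_add_of_commute
      (Commute.refl _).neg_left]
    simp
  have h4 := h 4
  have h3 := h 3
  have h2 := h 2
  have h1 := h 1
  have h0 := h 0 1
  rw [show (4 : Fin 5).rev = 0 from rfl] at h4
  rw [show (3 : Fin 5).rev = 1 from rfl] at h3
  rw [show (2 : Fin 5).rev = 2 from rfl] at h2
  rw [show (1 : Fin 5).rev = 3 from rfl] at h1
  rw [show (0 : Fin 5).rev = 4 from rfl, mul_one] at h0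
  simp only [mul_assoc, h4, h3, h2, h1, h0]

theorem compSeries_nil (x : Matrix (Fin 5) (Fin 3) ℝ) : compSeries x [] = 1 := by
  simp [compSeries, conv, expSeries_of_length_lt]

/-- A time-symmetric composition whose odd coefficients up to order `5` are those of the
propagator reproduces it to order `6`. -/
theorem midPropagator_sub_midComposition_isBigO {x : Matrix (Fin 5) (Fin 3) ℝ}
    (hx : IsAdmissible x) {T : Matrix (Fin N) (Fin N) ℂ} (hT : T.IsHermitian)
    {V : ℝ → Fin N → ℝ} (hV : ContDiff ℝ 6 V) {U : ℝ → ℝ → Matrix (Fin N) (Fin N) ℂ}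
    (hU : IsPropagator (hamiltonian T V) U)
    (hodd : ∀ m, ∀ k < 7, Odd k → wordSum
      (fun j => taylorCoeff (fun t => -Complex.I • hamiltonian T V t) j m) k (compSeries x) =
      midCoeff (fun j => taylorCoeff (fun t => -Complex.I • hamiltonian T V t) j m) k)
    {K : Set ℝ} (hK : IsCompact K) :
    (fun p : ℝ × ℝ => midPropagator U p.1 p.2 - midComposition x T V p.1 p.2)
      =O[𝓟 K ×ˢ 𝓝 (0 : ℝ)] fun p => p.2 ^ 7 := by
  have hH := hamiltonian_isHermitian hT V
  have hA : ContDiff ℝ (6 : ℕ) fun t => -Complex.I • hamiltonian T V t :=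
    contDiff_hamiltonian T hV
  have hall : ∀ m, ∀ k < 7, wordSum
      (fun j => taylorCoeff (fun t => -Complex.I • hamiltonian T V t) j m) k (compSeries x) =
      midCoeff (fun j => taylorCoeff (fun t => -Complex.I • hamiltonian T V t) j m) k := by
    intro m
    -- Coefficients are compared at each fixed m, on the fibre over {m}; uniformity in m comes from
    -- the remainders over K below.
    have ht : Tendsto (fun s : ℝ => (m, s)) (𝓝[≠] 0) (𝓟 {m} ×ˢ 𝓝 (0 : ℝ)) := by
      refine Tendsto.prodMk ?_ (tendsto_id.mono_left nhdsWithin_le_nhds)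
      exact tendsto_principal.2 (Eventually.of_forall fun _ => rfl)
    have h1 := (isWordExpansion_midComposition x T hV (isCompact_singleton (x := m))).comp_tendsto ht
    have h2 := (hU.isExpansion_midPropagator hH (isCompact_singleton (x := m)) hA).comp_tendsto ht
    exact coeff_eq_of_odd_coeff_eq h1 h2 (by simp [wordSum, compSeries_nil]) (by simp [midCoeff])
      (midComposition_neg_mul hx T V m) (hU.midPropagator_neg_mul hH m) (hodd m)
  have h1 := isWordExpansion_midComposition x T hV hK
  have h2 := hU.isExpansion_midPropagator hH hK hA
  refine (h2.remainder.sub h1.remainder).congr_left fun p => ?_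
  rw [Finset.sum_congr rfl fun k hk =>
    congrArg (p.2 ^ k • ·) (hall p.1 k (Finset.mem_range.1 hk)).symm]
  abel

theorem isOfOrder_composition {x : Matrix (Fin 5) (Fin 3) ℝ} (hx : IsAdmissible x)
    (hodd : ∀ (N : ℕ) (T : Matrix (Fin N) (Fin N) ℂ) (V : ℝ → Fin N → ℝ), ContDiff ℝ 6 V →
      ∀ m, ∀ k < 7, Odd k → wordSum
        (fun j => taylorCoeff (fun t => -Complex.I • hamiltonian T V t) j m) k (compSeries x) =
        midCoeff (fun j => taylorCoeff (fun t => -Complex.I • hamiltonian T V t) j m) k) :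
    IsOfOrder 6 (composition x) := by
  intro N T hT V hV U hU t₀ t₁
  have hV' : ContDiff ℝ 6 V := hV
  -- The estimate is used at the midpoint t + τ/2, which stays in [t₀, t₁ + 1] because τ ≤ 1.
  obtain ⟨C, hC⟩ := (midPropagator_sub_midComposition_isBigO hx hT hV' hU (hodd N T V hV')
    (isCompact_Icc (a := t₀) (b := t₁ + 1))).bound
  obtain ⟨ε, hε, hb⟩ := eventually_principal_prod_nhds_zero.1 hC
  refine ⟨C, min 1 (ε / 2), by positivity, fun t ht τ hτ => ?_⟩
  have h1 : τ ≤ 1 := hτ.2.trans (min_le_left _ _)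
  have h2 : τ ≤ ε / 2 := hτ.2.trans (min_le_right _ _)
  have h := hb (t + 1 / 2 * τ) ⟨by linarith [ht.1, hτ.1], by linarith [ht.2]⟩ τ
    (by rw [abs_of_nonneg hτ.1]; linarith)
  have e1 : t + 1 / 2 * τ + 1 / 2 * τ = t + τ := by ring
  have e2 : t + 1 / 2 * τ + -1 / 2 * τ = t := by ring
  simp only [midPropagator, midComposition, e1, e2, norm_pow, Real.norm_eq_abs,
    abs_of_nonneg hτ.1] at h
  exact h

/-- A method of order `6` has the coefficients of the propagator. -/
theorem wordSum_compSeries_eq {x : Matrix (Fin 5) (Fin 3) ℝ} (hx : IsOfOrder 6 (composition x))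
    {T : Matrix (Fin N) (Fin N) ℂ} (hT : T.IsHermitian) {V : ℝ → Fin N → ℝ}
    (hV : ContDiff ℝ 6 V) (m : ℝ) {k : ℕ} (hk : k < 7) :
    wordSum (fun j => taylorCoeff (fun t => -Complex.I • hamiltonian T V t) j m) k (compSeries x) =
      midCoeff (fun j => taylorCoeff (fun t => -Complex.I • hamiltonian T V t) j m) k := by
  obtain ⟨U, hU⟩ := exists_isPropagator T hV.continuous
  have hH := hamiltonian_isHermitian hT V
  have hA : ContDiff ℝ (6 : ℕ) fun t => -Complex.I • hamiltonian T V t :=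
    contDiff_hamiltonian T hV
  obtain ⟨C, ε, hε, hb⟩ := hx N T hT V hV U hU (m - 1) m
  -- The order condition speaks only of τ ≥ 0, so the limit is one-sided. The initial times m - s/2
  -- lie in [m - 1, m].
  have ht : Tendsto (fun s : ℝ => (m, s)) (𝓝[>] 0) (𝓟 {m} ×ˢ 𝓝 (0 : ℝ)) := by
    refine Tendsto.prodMk ?_ (tendsto_id.mono_left nhdsWithin_le_nhds)
    exact tendsto_principal.2 (Eventually.of_forall fun _ => rfl)
  have h1 := (isWordExpansion_midComposition x T hV (isCompact_singleton (x := m))).comp_tendsto ht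
  have h2 := (hU.isExpansion_midPropagator hH (isCompact_singleton (x := m)) hA).comp_tendsto ht
  have h3 : (fun s => midComposition x T V m s - midPropagator U m s) =O[𝓝[>] 0]
      fun s : ℝ => s ^ 7 := by
    refine IsBigO.of_bound C ?_
    filter_upwards [Ioo_mem_nhdsGT (show (0 : ℝ) < min 1 ε by positivity)] with s hs
    have hs1 : s < 1 := hs.2.trans_le (min_le_left _ _)
    have hs2 : s < ε := hs.2.trans_le (min_le_right _ _)
    have h := hb (m + -1 / 2 * s) ⟨by linarith [hs.1], by linarith [hs.1]⟩ s ⟨hs.1.le, hs2.le⟩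
    have e1 : m + -1 / 2 * s + s = m + 1 / 2 * s := by ring
    rw [e1] at h
    rw [norm_sub_rev]
    simp only [norm_pow, Real.norm_eq_abs, abs_of_pos hs.1]
    exact h
  have h4 := (h1.sub h2).coeff_eq_zero (φ := fun k =>
    wordSum (fun j => taylorCoeff (fun t => -Complex.I • hamiltonian T V t) j m) k (compSeries x) -
      midCoeff (fun j => taylorCoeff (fun t => -Complex.I • hamiltonian T V t) j m) k)
    (tendsto_id.mono_left nhdsWithin_le_nhds)
    (by filter_upwards [self_mem_nhdsWithin] with s hs using ne_of_gt hs) h3 k hk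
  exact sub_eq_zero.1 h4

/-- T is constant in time, so the derivatives of the Hamiltonian are those of V and hence diagonal.
-/
theorem taylorCoeff_hamiltonian_commute (T : Matrix (Fin N) (Fin N) ℂ) {V : ℝ → Fin N → ℝ}
    (hV : ContDiff ℝ 6 V) (m : ℝ) :
    Commute (taylorCoeff (fun t => -Complex.I • hamiltonian T V t) 1 m)
      (taylorCoeff (fun t => -Complex.I • hamiltonian T V t) 2 m) := by
  have hd : ∀ W : ℝ → Fin N → ℝ, Differentiable ℝ W → ∀ T : Matrix (Fin N) (Fin N) ℂ,
      deriv (fun t => -Complex.I • (T + potential (W t))) =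
        fun t => -Complex.I • potential (deriv W t) := by
    intro W hW T
    funext t
    have h := (potentialCLM N).hasFDerivAt.comp_hasDerivAt t (hW t).hasDerivAt
    exact ((h.const_add T).const_smul (-Complex.I)).deriv
  have hV1 : Differentiable ℝ V := hV.differentiable (by norm_num)
  have hV2 : Differentiable ℝ (deriv V) := by
    have : ContDiff ℝ (5 + 1) V := by convert hV; norm_num
    exact (contDiff_succ_iff_deriv.1 this).2.2.differentiable (by norm_num)
  have h1 : deriv (fun t => -Complex.I • hamiltonian T V t) =
      fun t => -Complex.I • potential (deriv V t) := hd V hV1 T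
  have h2 : deriv (fun t => -Complex.I • potential (deriv V t)) =
      fun t => -Complex.I • potential (deriv (deriv V) t) := by
    simpa using hd (deriv V) hV2 0
  simp only [taylorCoeff, iteratedDeriv_succ', iteratedDeriv_zero, h1, h2]
  refine Commute.smul_left (Commute.smul_right ?_ _) _
  refine Commute.smul_left (Commute.smul_right ?_ _) _
  simp only [potential, Commute, SemiconjBy, Matrix.diagonal_mul_diagonal, mul_comm]

end Composition

/-! ### The conditions of weights 1, 3 and 5, and their sufficiency. -/

section OrderConditions

/-- The time-symmetric coefficient matrices with `x_{1,1} = x_{1,3} = 0`. -/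
def schemeMatrix (q p r s u v : ℝ) : Matrix (Fin 5) (Fin 3) ℝ :=
  !![0, q, 0; p, r, s; u, 0, v; p, -r, s; 0, -q, 0]

theorem isAdmissible_schemeMatrix (q p r s u v : ℝ) :
    IsAdmissible (schemeMatrix q p r s u v) := by
  refine ⟨fun i j => ?_, rfl, rfl⟩
  fin_cases i <;> fin_cases j <;> simp [schemeMatrix, Fin.rev]

theorem IsAdmissible.eq_schemeMatrix {x : Matrix (Fin 5) (Fin 3) ℝ} (hx : IsAdmissible x) :
    x = schemeMatrix (x 0 1) (x 1 0) (x 1 1) (x 1 2) (x 2 0) (x 2 2) := by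
  obtain ⟨h, h1, h2⟩ := hx
  have h3 : x 2 1 = 0 := by
    have := h 2 1
    rw [show (2 : Fin 5).rev = 2 from rfl] at this
    simp at this
    linarith
  ext i j
  fin_cases i
  · fin_cases j <;> simp [schemeMatrix, h1, h2]
  · fin_cases j <;> simp [schemeMatrix]
  · fin_cases j <;> simp [schemeMatrix, h3]
  · have := fun j => h 1 j
    rw [show (1 : Fin 5).rev = 3 from rfl] at this
    fin_cases j <;> simp [schemeMatrix, this]
  · have := fun j => h 0 j
    rw [show (0 : Fin 5).rev = 4 from rfl] at this
    fin_cases j <;> simp [schemeMatrix, this, h1, h2]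

theorem compSeries_schemeMatrix (q p r s u v : ℝ) : compSeries (schemeMatrix q p r s u v) =
    conv (conv (conv (conv (expSeries (letterCoeff ![0, -q, 0]))
      (expSeries (letterCoeff ![p, -r, s]))) (expSeries (letterCoeff ![u, 0, v])))
      (expSeries (letterCoeff ![p, r, s]))) (expSeries (letterCoeff ![0, q, 0])) := rfl

theorem compSeries_schemeMatrix_zero (q p r s u v : ℝ) :
    compSeries (schemeMatrix q p r s u v) [0] = 2 * p + u := by
  simp [compSeries_schemeMatrix, conv, expSeries_of_length_lt, letterCoeff]
  ring

theorem compSeries_schemeMatrix_two (q p r s u v : ℝ) :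
    compSeries (schemeMatrix q p r s u v) [2] = 2 * s + v := by
  simp [compSeries_schemeMatrix, conv, expSeries_of_length_lt, letterCoeff]
  ring

/-- The matrices that satisfy the conditions of weight one and the condition for `α₃`. -/
noncomputable def consistentMatrix (q p r s : ℝ) : Matrix (Fin 5) (Fin 3) ℝ :=
  schemeMatrix q p r s (1 - 2 * p) (1 / 12 - 2 * s)

/-- This and the following evaluations cover the words of weights 3 and 5 other than `[2]`. Apart
from `[1, 2]` and `[2, 1]`, they are arranged so that the unknowns enter only through the left-hand
sides of `SixthOrderEquations` and p(p - 1). The conditions for a_4 and for the products of a_0 and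
a_3 are 3/20 times lower ones and impose nothing new. -/
theorem compSeries_0_1 (q p r s : ℝ) :
    compSeries (consistentMatrix q p r s) [0, 1] =
      q + (1 - p) * r := by
  simp [consistentMatrix, compSeries_schemeMatrix, conv, expSeries_of_length_lt, letterCoeff]
  ring

theorem compSeries_1_0 (q p r s : ℝ) :
    compSeries (consistentMatrix q p r s) [1, 0] =
      -(q + (1 - p) * r) := by
  simp [consistentMatrix, compSeries_schemeMatrix, conv, expSeries_of_length_lt, letterCoeff]
  ring

theorem compSeries_0_0_0 (q p r s : ℝ) :
    compSeries (consistentMatrix q p r s) [0, 0, 0] =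
      1 / 6 := by
  simp [consistentMatrix, compSeries_schemeMatrix, conv, expSeries_of_length_lt, letterCoeff]
  ring

theorem compSeries_4 (q p r s : ℝ) :
    compSeries (consistentMatrix q p r s) [4] =
      1 / 80 := by
  simp [consistentMatrix, compSeries_schemeMatrix, conv, expSeries_of_length_lt, letterCoeff]
  ring

theorem compSeries_0_3 (q p r s : ℝ) :
    compSeries (consistentMatrix q p r s) [0, 3] =
      3 / 20 * (q + (1 - p) * r) := by
  simp [consistentMatrix, compSeries_schemeMatrix, conv, expSeries_of_length_lt, letterCoeff]
  ring

theorem compSeries_3_0 (q p r s : ℝ) :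
    compSeries (consistentMatrix q p r s) [3, 0] =
      -(3 / 20 * (q + (1 - p) * r)) := by
  simp [consistentMatrix, compSeries_schemeMatrix, conv, expSeries_of_length_lt, letterCoeff]
  ring

/-- This value is never matched with the propagator's 1/240. The words `[1, 2]` and `[2, 1]` carry
opposite coefficients on both sides, so their contributions vanish when a_1 and a_2 commute. -/
theorem compSeries_1_2 (q p r s : ℝ) :
    compSeries (consistentMatrix q p r s) [1, 2] =
      r * s - (q + r) / 12 := by
  simp [consistentMatrix, compSeries_schemeMatrix, conv, expSeries_of_length_lt, letterCoeff]
  ring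

theorem compSeries_2_1 (q p r s : ℝ) :
    compSeries (consistentMatrix q p r s) [2, 1] =
      -(r * s - (q + r) / 12) := by
  simp [consistentMatrix, compSeries_schemeMatrix, conv, expSeries_of_length_lt, letterCoeff]
  ring

theorem compSeries_0_0_2 (q p r s : ℝ) :
    compSeries (consistentMatrix q p r s) [0, 0, 2] =
      1 / 72 + p * (p - 1) / 72 - (p - 1) * s / 6 := by
  simp [consistentMatrix, compSeries_schemeMatrix, conv, expSeries_of_length_lt, letterCoeff]
  ring

theorem compSeries_2_0_0 (q p r s : ℝ) :
    compSeries (consistentMatrix q p r s) [2, 0, 0] =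
      1 / 72 + p * (p - 1) / 72 - (p - 1) * s / 6 := by
  simp [consistentMatrix, compSeries_schemeMatrix, conv, expSeries_of_length_lt, letterCoeff]
  ring

theorem compSeries_0_2_0 (q p r s : ℝ) :
    compSeries (consistentMatrix q p r s) [0, 2, 0] =
      1 / 72 - p * (p - 1) / 36 + (p - 1) * s / 3 := by
  simp [consistentMatrix, compSeries_schemeMatrix, conv, expSeries_of_length_lt, letterCoeff]
  ring

theorem compSeries_0_1_1 (q p r s : ℝ) :
    compSeries (consistentMatrix q p r s) [0, 1, 1] =
      (q + (1 - p) * r) ^ 2 / 2 - p * (p - 2 / 3) * r ^ 2 / 2 := by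
  simp [consistentMatrix, compSeries_schemeMatrix, conv, expSeries_of_length_lt, letterCoeff]
  ring

theorem compSeries_1_1_0 (q p r s : ℝ) :
    compSeries (consistentMatrix q p r s) [1, 1, 0] =
      (q + (1 - p) * r) ^ 2 / 2 - p * (p - 2 / 3) * r ^ 2 / 2 := by
  simp [consistentMatrix, compSeries_schemeMatrix, conv, expSeries_of_length_lt, letterCoeff]
  ring

theorem compSeries_1_0_1 (q p r s : ℝ) :
    compSeries (consistentMatrix q p r s) [1, 0, 1] =
      p * (p - 2 / 3) * r ^ 2 - (q + (1 - p) * r) ^ 2 := by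
  simp [consistentMatrix, compSeries_schemeMatrix, conv, expSeries_of_length_lt, letterCoeff]
  ring

theorem compSeries_0_0_0_1 (q p r s : ℝ) :
    compSeries (consistentMatrix q p r s) [0, 0, 0, 1] =
      (q + (1 - p) * r) / 6 - p * (1 - p) ^ 2 * r / 12 := by
  simp [consistentMatrix, compSeries_schemeMatrix, conv, expSeries_of_length_lt, letterCoeff]
  ring

theorem compSeries_1_0_0_0 (q p r s : ℝ) :
    compSeries (consistentMatrix q p r s) [1, 0, 0, 0] =
      -((q + (1 - p) * r) / 6 - p * (1 - p) ^ 2 * r / 12) := by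
  simp [consistentMatrix, compSeries_schemeMatrix, conv, expSeries_of_length_lt, letterCoeff]
  ring

theorem compSeries_0_0_1_0 (q p r s : ℝ) :
    compSeries (consistentMatrix q p r s) [0, 0, 1, 0] =
      p * (1 - p) ^ 2 * r / 4 := by
  simp [consistentMatrix, compSeries_schemeMatrix, conv, expSeries_of_length_lt, letterCoeff]
  ring

theorem compSeries_0_1_0_0 (q p r s : ℝ) :
    compSeries (consistentMatrix q p r s) [0, 1, 0, 0] =
      -(p * (1 - p) ^ 2 * r / 4) := by
  simp [consistentMatrix, compSeries_schemeMatrix, conv, expSeries_of_length_lt, letterCoeff]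
  ring

theorem compSeries_0_0_0_0_0 (q p r s : ℝ) :
    compSeries (consistentMatrix q p r s) [0, 0, 0, 0, 0] =
      1 / 120 := by
  simp [consistentMatrix, compSeries_schemeMatrix, conv, expSeries_of_length_lt, letterCoeff]
  ring

/-- The polynomial equations that remain for the coefficients `x_{1,2}, x_{2,1}, x_{2,2}, x_{2,3}`
of a scheme of order six. -/
structure SixthOrderEquations (q p r s : ℝ) : Prop where
  eq_zero_one : q + (1 - p) * r = -1 / 12
  eq_zero_two_zero : (p - 1) * s = p * (p - 1) / 12 - 1 / 60
  eq_zero_zero_one_zero : p * (1 - p) ^ 2 * r = -1 / 60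
  eq_one_zero_one : p * (p - 2 / 3) * r ^ 2 = -1 / 720

section MidCoeff

variable {E : Type*} [NormedRing E] [NormedAlgebra ℝ E] (a : ℕ → E)

theorem midCoeff_one : midCoeff a 1 = a 0 := by
  simp [midCoeff]
  module

theorem midCoeff_two : midCoeff a 2 = (1 / 2 : ℝ) • (a 0 * a 0) := by
  simp [midCoeff_succ _ 1, Finset.sum_range_succ, midCoeff_one]
  simp [midCoeff]
  module

theorem midCoeff_three : midCoeff a 3 = (1 / 12 : ℝ) • a 2 + (1 / 12 : ℝ) • (a 1 * a 0) -
    (1 / 12 : ℝ) • (a 0 * a 1) + (1 / 6 : ℝ) • (a 0 * (a 0 * a 0)) := by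
  simp [midCoeff_succ _ 2, Finset.sum_range_succ, midCoeff_one, midCoeff_two, mul_assoc]
  simp [midCoeff]
  module

theorem midCoeff_four : midCoeff a 4 = (1 / 24 : ℝ) • (a 0 * a 2 + a 2 * a 0) +
    (1 / 24 : ℝ) • (a 1 * (a 0 * a 0) - a 0 * (a 0 * a 1)) +
    (1 / 24 : ℝ) • (a 0 * (a 0 * (a 0 * a 0))) := by
  simp [midCoeff_succ _ 3, Finset.sum_range_succ, midCoeff_one, midCoeff_two, midCoeff_three,
    mul_assoc, mul_add, add_mul, mul_sub, sub_mul]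
  simp [midCoeff]
  module

theorem midCoeff_five : midCoeff a 5 = (1 / 80 : ℝ) • a 4 +
    (1 / 80 : ℝ) • (a 3 * a 0 - a 0 * a 3) + (1 / 240 : ℝ) • (a 1 * a 2 - a 2 * a 1) +
    (1 / 60 : ℝ) • (a 0 * (a 0 * a 2) + a 2 * (a 0 * a 0)) + (1 / 120 : ℝ) • (a 0 * (a 2 * a 0)) +
    (1 / 240 : ℝ) • (a 0 * (a 1 * a 1) + a 1 * (a 1 * a 0)) -
    (1 / 120 : ℝ) • (a 1 * (a 0 * a 1)) +
    (1 / 80 : ℝ) • (a 1 * (a 0 * (a 0 * a 0)) - a 0 * (a 0 * (a 0 * a 1))) +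
    (1 / 240 : ℝ) • (a 0 * (a 1 * (a 0 * a 0)) - a 0 * (a 0 * (a 1 * a 0))) +
    (1 / 120 : ℝ) • (a 0 * (a 0 * (a 0 * (a 0 * a 0)))) := by
  simp [midCoeff_succ _ 4, Finset.sum_range_succ, midCoeff_one, midCoeff_two, midCoeff_three,
    midCoeff_four, mul_assoc, mul_add, add_mul, mul_sub, sub_mul]
  simp [midCoeff]
  module

variable (c : List ℕ → ℝ)

theorem wordSum_one : wordSum a 1 c = c [0] • a 0 := by
  simp [wordSum]

theorem wordSum_three : wordSum a 3 c = c [2] • a 2 + c [1, 0] • (a 1 * a 0) +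
    c [0, 1] • (a 0 * a 1) + c [0, 0, 0] • (a 0 * (a 0 * a 0)) := by
  simp [wordSum, Fin.sum_univ_succ, mul_add]
  module

theorem wordSum_five : wordSum a 5 c = c [4] • a 4 +
    c [3, 0] • (a 3 * a 0) + c [0, 3] • (a 0 * a 3) +
    c [1, 2] • (a 1 * a 2) + c [2, 1] • (a 2 * a 1) +
    c [0, 0, 2] • (a 0 * (a 0 * a 2)) + c [2, 0, 0] • (a 2 * (a 0 * a 0)) +
    c [0, 2, 0] • (a 0 * (a 2 * a 0)) +
    c [0, 1, 1] • (a 0 * (a 1 * a 1)) + c [1, 1, 0] • (a 1 * (a 1 * a 0)) +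
    c [1, 0, 1] • (a 1 * (a 0 * a 1)) +
    c [1, 0, 0, 0] • (a 1 * (a 0 * (a 0 * a 0))) + c [0, 0, 0, 1] • (a 0 * (a 0 * (a 0 * a 1))) +
    c [0, 1, 0, 0] • (a 0 * (a 1 * (a 0 * a 0))) + c [0, 0, 1, 0] • (a 0 * (a 0 * (a 1 * a 0))) +
    c [0, 0, 0, 0, 0] • (a 0 * (a 0 * (a 0 * (a 0 * a 0)))) := by
  simp [wordSum, Fin.sum_univ_succ, mul_add]
  module

theorem SixthOrderEquations.wordSum_eq {q p r s : ℝ} (h : SixthOrderEquations q p r s)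
    (ha : Commute (a 1) (a 2)) {k : ℕ} (hk : k < 7) (hodd : Odd k) :
    wordSum a k (compSeries (consistentMatrix q p r s)) = midCoeff a k := by
  obtain ⟨h1, h2, h3, h4⟩ := h
  have hk' : k = 1 ∨ k = 3 ∨ k = 5 := by
    obtain ⟨j, rfl⟩ := hodd
    omega
  have e0 : compSeries (consistentMatrix q p r s) [0] = 1 := by
    rw [consistentMatrix, compSeries_schemeMatrix_zero]; ring
  have e2 : compSeries (consistentMatrix q p r s) [2] = 1 / 12 := by
    rw [consistentMatrix, compSeries_schemeMatrix_two]; ring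
  rcases hk' with rfl | rfl | rfl
  · rw [wordSum_one, midCoeff_one, e0, one_smul]
  · rw [wordSum_three, midCoeff_three, e2, compSeries_0_1, compSeries_1_0, compSeries_0_0_0, h1]
    module
  · have ha' : a 2 * a 1 = a 1 * a 2 := ha.symm
    rw [wordSum_five, midCoeff_five, compSeries_4, compSeries_3_0, compSeries_0_3, compSeries_1_2,
      compSeries_2_1, compSeries_0_0_2, compSeries_2_0_0, compSeries_0_2_0, compSeries_0_1_1,
      compSeries_1_1_0, compSeries_1_0_1, compSeries_1_0_0_0, compSeries_0_0_0_1,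
      compSeries_0_1_0_0, compSeries_0_0_1_0, compSeries_0_0_0_0_0, h1, h2, h3, h4, ha']
    module

end MidCoeff

open scoped Matrix.Norms.L2Operator in
theorem SixthOrderEquations.isOfOrder {q p r s : ℝ} (h : SixthOrderEquations q p r s) :
    IsOfOrder 6 (composition (consistentMatrix q p r s)) :=
  isOfOrder_composition (isAdmissible_schemeMatrix _ _ _ _ _ _) fun _ T _ hV m _ hk hodd =>
    h.wordSum_eq _ (taylorCoeff_hamiltonian_commute T hV m) hk hodd

end OrderConditions

/-! ### Necessity of the conditions from a two-level test problem. -/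

section Necessity

open scoped Matrix.Norms.L2Operator

/-- The Pauli matrix `σ₁`. -/
def pauliX : Matrix (Fin 2) (Fin 2) ℂ := !![0, 1; 1, 0]

/-- The Pauli matrix `σ₃`. -/
def pauliZ : Matrix (Fin 2) (Fin 2) ℂ := !![1, 0; 0, -1]

theorem taylorCoeff_quadratic {E : Type*} [NormedAddCommGroup E] [NormedSpace ℝ E] (b d : E) :
    (taylorCoeff (fun t : ℝ => b + (t + t ^ 2) • d) 0 0 = b ∧
      taylorCoeff (fun t : ℝ => b + (t + t ^ 2) • d) 1 0 = d) ∧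
      taylorCoeff (fun t : ℝ => b + (t + t ^ 2) • d) 2 0 = d ∧
      taylorCoeff (fun t : ℝ => b + (t + t ^ 2) • d) 3 0 = 0 ∧
      taylorCoeff (fun t : ℝ => b + (t + t ^ 2) • d) 4 0 = 0 := by
  have h1 : deriv (fun t : ℝ => b + (t + t ^ 2) • d) = fun t => (1 + 2 * t) • d := by
    funext t
    have h : HasDerivAt (fun t : ℝ => t + t ^ 2) (1 + 2 * t) t := by
      simpa using (hasDerivAt_id' t).fun_add (hasDerivAt_pow 2 t)
    exact ((h.smul_const d).const_add b).deriv
  have h2 : deriv (fun t : ℝ => (1 + 2 * t) • d) = fun t => (2 : ℝ) • d := by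
    funext t
    have h : HasDerivAt (fun t : ℝ => 1 + 2 * t) 2 t := by
      simpa using ((hasDerivAt_id t).const_mul 2).const_add 1
    exact (h.smul_const d).deriv
  refine ⟨⟨?_, ?_⟩, ?_, ?_, ?_⟩ <;>
    simp [taylorCoeff, iteratedDeriv_succ', h1, h2]

/-- The potential (t + t²)σ₃ at midpoint 0 has equal nonzero first and second Taylor coefficients
and no higher ones, so one problem tests words in a_1 and in a_2 at once. -/
theorem wordSum_pauli {x : Matrix (Fin 5) (Fin 3) ℝ} (hx : IsOfOrder 6 (composition x)) :
    ∃ a : ℕ → Matrix (Fin 2) (Fin 2) ℂ, a 0 = -Complex.I • pauliX ∧ a 1 = -Complex.I • pauliZ ∧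
      a 2 = -Complex.I • pauliZ ∧ a 3 = 0 ∧ a 4 = 0 ∧
      ∀ k < 7, wordSum a k (compSeries x) = midCoeff a k := by
  have hT : pauliX.IsHermitian := by
    ext i j
    fin_cases i <;> fin_cases j <;> simp [pauliX]
  have hV : ContDiff ℝ 6 fun t : ℝ => (t + t ^ 2) • (![1, -1] : Fin 2 → ℝ) := by
    fun_prop
  have hA : (fun t : ℝ => -Complex.I • hamiltonian pauliX
      (fun t : ℝ => (t + t ^ 2) • (![1, -1] : Fin 2 → ℝ)) t) =
      fun t : ℝ => (-Complex.I • pauliX) + (t + t ^ 2) • (-Complex.I • pauliZ) := by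
    funext t
    have h : potential (![1, -1] : Fin 2 → ℝ) = pauliZ := by
      ext i j
      fin_cases i <;> fin_cases j <;> simp [potential, pauliZ]
    rw [hamiltonian, potential_smul, h, smul_add, smul_comm]
  have h := fun k (hk : k < 7) => wordSum_compSeries_eq hx hT hV 0 hk
  rw [hA] at h
  obtain ⟨⟨h0, h1⟩, h2, h3, h4⟩ :=
    taylorCoeff_quadratic (-Complex.I • pauliX) (-Complex.I • pauliZ)
  exact ⟨_, h0, h1, h2, h3, h4, h⟩

/-- The Pauli matrices square to 1 and anticommute, so each word is a scalar times 1, σ₁, σ₃ or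
σ₁σ₃. The parity of the number of factors σ₁ decides between diagonal and off-diagonal entries, and
the parity of the length between real and imaginary ones; three of these four parts give the three
relations. -/
theorem pauli_wordSum_five {a : ℕ → Matrix (Fin 2) (Fin 2) ℂ} (a0 : a 0 = -Complex.I • pauliX)
    (a1 : a 1 = -Complex.I • pauliZ) (a2 : a 2 = -Complex.I • pauliZ) (a3 : a 3 = 0) (a4 : a 4 = 0)
    {c : List ℕ → ℝ} (h : wordSum a 5 c = midCoeff a 5) :
    c [0, 0, 2] + c [2, 0, 0] - c [0, 2, 0] = 1 / 40 ∧
    c [0, 0, 0, 1] + c [0, 1, 0, 0] - c [1, 0, 0, 0] - c [0, 0, 1, 0] = -1 / 60 ∧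
    c [0, 1, 1] + c [1, 1, 0] - c [1, 0, 1] - c [0, 0, 0, 0, 0] = 1 / 120 := by
  rw [wordSum_five, midCoeff_five, a0, a1, a2, a3, a4] at h
  refine ⟨?_, ?_, ?_⟩
  · have := congrArg Complex.im (congrFun (congrFun h 0) 0)
    simp [pauliX, pauliZ] at this
    linarith
  · have := congrArg Complex.re (congrFun (congrFun h 0) 1)
    simp [pauliX, pauliZ] at this
    linarith
  · have := congrArg Complex.im (congrFun (congrFun h 0) 1)
    simp [pauliX, pauliZ] at this
    linarith

theorem sixthOrderEquations_of_isOfOrder {q p r s u v : ℝ}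
    (hx : IsOfOrder 6 (composition (schemeMatrix q p r s u v))) :
    u = 1 - 2 * p ∧ v = 1 / 12 - 2 * s ∧ SixthOrderEquations q p r s := by
  obtain ⟨a, a0, a1, a2, a3, a4, h⟩ := wordSum_pauli hx
  have w1 := h 1 (by norm_num)
  have w3 := h 3 (by norm_num)
  have w5 := pauli_wordSum_five a0 a1 a2 a3 a4 (h 5 (by norm_num))
  rw [wordSum_one, midCoeff_one, a0, compSeries_schemeMatrix_zero] at w1
  have hu : u = 1 - 2 * p := by
    have := congrArg Complex.im (congrFun (congrFun w1 0) 1)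
    simp [pauliX] at this
    linarith
  rw [wordSum_three, midCoeff_three, a0, a1, a2, compSeries_schemeMatrix_two] at w3
  have hv : v = 1 / 12 - 2 * s := by
    have := congrArg Complex.im (congrFun (congrFun w3 0) 0)
    simp [pauliX, pauliZ] at this
    linarith
  refine ⟨hu, hv, ?_⟩
  subst hu hv
  have h1 : q + (1 - p) * r = -1 / 12 := by
    have := congrArg Complex.re (congrFun (congrFun w3 0) 1)
    simp [pauliX, pauliZ] at this
    have e1 := compSeries_0_1 q p r s
    have e2 := compSeries_1_0 q p r s
    simp only [consistentMatrix, one_div] at e1 e2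
    rw [e1, e2] at this
    linarith
  rw [← consistentMatrix.eq_1] at w5
  obtain ⟨w1, w2, w3⟩ := w5
  rw [compSeries_0_0_2, compSeries_2_0_0, compSeries_0_2_0] at w1
  rw [compSeries_0_0_0_1, compSeries_0_1_0_0, compSeries_1_0_0_0, compSeries_0_0_1_0, h1] at w2
  rw [compSeries_0_1_1, compSeries_1_1_0, compSeries_1_0_1, compSeries_0_0_0_0_0, h1] at w3
  exact ⟨h1, by linarith, by linarith, by linarith⟩

end Necessity

/-! ### Elimination to one polynomial and its unique real root. -/

section Root

/-- The coefficient `x_{2,1}` of a scheme of order six is a root of this polynomial. -/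
def rootPoly (p : ℝ) : ℝ := 15 * p * (1 - p) ^ 4 + 3 * p - 2

theorem rootPoly_neg {p : ℝ} (hp : p ≤ 1 / 2) : rootPoly p < 0 := by
  unfold rootPoly
  rcases le_or_gt p 0 with h | h
  · have := mul_nonneg (neg_nonneg.2 h) (by positivity : 0 ≤ (1 - p) ^ 4)
    nlinarith
  -- The polynomial has a local maximum of about -0.012 near p = 1/3, so the estimate is tight
  -- there; this is why most of the squares are centred at 1/3.
  · nlinarith [mul_nonneg h.le (sq_nonneg (p ^ 2 - p)), mul_nonneg h.le (sq_nonneg (p - 1 / 3)),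
      mul_nonneg (sub_nonneg.2 hp) (sq_nonneg (p - 1 / 3)), sq_nonneg (p - 1 / 3),
      mul_nonneg h.le (sq_nonneg (p ^ 2 - 5 / 3 * p + 4 / 9)),
      mul_nonneg (mul_nonneg h.le (sub_nonneg.2 hp)) (sq_nonneg (p - 1 / 3)),
      mul_nonneg (sub_nonneg.2 hp) (sq_nonneg ((p - 1 / 3) * p)),
      mul_nonneg (sub_nonneg.2 hp) (sq_nonneg ((p - 1 / 3) * (p - 1)))]

theorem rootPoly_strictMono {x y : ℝ} (hx : 1 / 2 ≤ x) (hxy : x < y) : rootPoly x < rootPoly y := by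
  have hd : ∀ p, HasDerivAt rootPoly (15 * (1 - p) ^ 3 * (1 - 5 * p) + 3) p := by
    intro p
    have h1 := ((hasDerivAt_id p).const_sub 1).fun_pow 4
    have h2 := ((((hasDerivAt_id p).const_mul 15).mul h1).add
      ((hasDerivAt_id p).const_mul 3)).sub_const 2
    refine h2.congr_deriv ?_
    simp
    ring
  have hmono : StrictMonoOn rootPoly (Set.Ici (1 / 2)) := by
    refine strictMonoOn_of_deriv_pos (convex_Ici _)
      (fun p _ => (hd p).continuousAt.continuousWithinAt) fun p hp => ?_
    rw [interior_Ici, Set.mem_Ioi] at hp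
    rw [(hd p).deriv]
    rcases le_or_gt 1 p with h | h
    · have := mul_nonneg (pow_nonneg (sub_nonneg.2 h) 3) (by linarith : 0 ≤ 5 * p - 1)
      nlinarith
    -- The two bounds give 15 (1 - p)³ (5p - 1) < 15 · (1/4) · (4/5) = 3, exactly what positivity of
    -- the derivative requires. The second is sharp at p = 3/5.
    · have h1 : (1 - p) ^ 2 < 1 / 4 := by nlinarith
      have h2 : (1 - p) * (5 * p - 1) ≤ 4 / 5 := by nlinarith [sq_nonneg (5 * p - 3)]
      have h3 : 0 < (1 - p) * (5 * p - 1) := mul_pos (by linarith) (by linarith)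
      nlinarith
  exact hmono hx (hx.trans hxy.le) hxy

theorem eq_of_rootPoly_eq_zero {x y : ℝ} (hx : rootPoly x = 0) (hy : rootPoly y = 0) : x = y := by
  have h1 : 1 / 2 ≤ x := by
    by_contra! h
    exact (rootPoly_neg h.le).ne hx
  have h2 : 1 / 2 ≤ y := by
    by_contra! h
    exact (rootPoly_neg h.le).ne hy
  rcases lt_trichotomy x y with h | h | h
  · linarith [rootPoly_strictMono h1 h]
  · exact h
  · linarith [rootPoly_strictMono h2 h]

theorem exists_rootPoly_eq_zero : ∃ p : ℝ, rootPoly p = 0 ∧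
    p ∈ Set.Icc (0.567040718865477427574416649845032 : ℝ) 0.567040718865477427574416649845033 := by
  have hc : Continuous rootPoly := by unfold rootPoly; fun_prop
  obtain ⟨p, hp, h⟩ := intermediate_value_Icc (α := ℝ)
    (a := 0.567040718865477427574416649845032) (b := 0.567040718865477427574416649845033)
    (by norm_num) hc.continuousOn (show (0 : ℝ) ∈ _ by unfold rootPoly; constructor <;> norm_num)
  exact ⟨p, h, hp⟩

theorem SixthOrderEquations.rootPoly_eq_zero {q p r s : ℝ} (h : SixthOrderEquations q p r s) :
    rootPoly p = 0 ∧ q = -1 / 12 - (1 - p) * r ∧ r = -1 / (60 * (p * (1 - p) ^ 2)) ∧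
      s = p / 12 + 1 / (60 * (1 - p)) := by
  obtain ⟨h1, h2, h3, h4⟩ := h
  have hp : p ≠ 0 := by rintro rfl; norm_num at h3
  have hp1 : 1 - p ≠ 0 := by intro h; rw [h] at h3; norm_num at h3
  refine ⟨?_, by linarith, ?_, ?_⟩
  · unfold rootPoly
    -- Multiplying the last equation by p(1 - p)⁴ turns its left-hand side into (p - 2/3)(p(1 -
    -- p)²r)², and the third equation gives the square as 1/3600.
    linear_combination 10800 * p * (1 - p) ^ 4 * h4 -
      10800 * (p - 2 / 3) * (p * (1 - p) ^ 2 * r - 1 / 60) * h3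
  · field_simp
    linarith
  · field_simp
    linarith

theorem sixthOrderEquations_of_rootPoly {p : ℝ} (h : rootPoly p = 0) :
    SixthOrderEquations (-1 / 12 - (1 - p) * (-1 / (60 * (p * (1 - p) ^ 2)))) p
      (-1 / (60 * (p * (1 - p) ^ 2))) (p / 12 + 1 / (60 * (1 - p))) := by
  unfold rootPoly at h
  have hp : p ≠ 0 := by rintro rfl; norm_num at h
  have hp1 : 1 - p ≠ 0 := by
    intro h1
    rw [h1] at h
    have : p = 1 := by linarith
    norm_num [this] at h
  refine ⟨by ring, ?_, ?_, ?_⟩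
  · field_simp
    ring
  · field_simp
  · field_simp
    linear_combination 720 * h

end Root

/-! ### Passage to node coefficients, and numerical enclosures. -/

section Main

open scoped Matrix.Norms.L2Operator

/-- The coefficients in terms of the potentials at the nodes. -/
noncomputable def nodeCoeff (x : Matrix (Fin 5) (Fin 3) ℝ) : Matrix (Fin 3) (Fin 3) ℝ :=
  Matrix.of fun i j => ∑ k : Fin 3, x (Fin.castLE (by norm_num) i) k * G k j

theorem smul_sum_alpha_eq {N : ℕ} (y : Fin 3 → ℝ) (T : Matrix (Fin N) (Fin N) ℂ)
    (V : ℝ → Fin N → ℝ) (t τ : ℝ) : -Complex.I • ∑ j, (y j : ℂ) • alpha T V t τ j =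
      (-Complex.I * τ) • ((y 0 : ℂ) • T + averagedPotential (fun j => ∑ k, y k * G k j) V t τ) := by
  simp only [Fin.sum_univ_three, alpha, averagedPotential, G, Matrix.cons_val_zero,
    Matrix.cons_val_one, Matrix.cons_val, Fin.isValue, Matrix.of_apply, Matrix.cons_val']
  push_cast
  module

/-- The first row of `G` sums to 1 and the others, being difference stencils, to 0. -/
theorem rowSum_nodeCoeff (x : Matrix (Fin 5) (Fin 3) ℝ) (i : Fin 3) :
    rowSum (nodeCoeff x) i = x (Fin.castLE (by norm_num) i) 0 := by
  simp [rowSum, nodeCoeff, Fin.sum_univ_three, G]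
  ring

/-- Reversing the nodes fixes the first and third rows of `G` and negates the second. This is the
sign change of time symmetry, so reversed coefficients describe the mirrored factors. T enters only
through α₁, so it is absent from the outer exponents. -/
theorem upsilon_nodeCoeff (q p r s u v : ℝ) {N : ℕ} (T : Matrix (Fin N) (Fin N) ℂ)
    (V : ℝ → Fin N → ℝ) (t τ : ℝ) :
    upsilon (nodeCoeff (schemeMatrix q p r s u v)) N T V t τ =
      composition (schemeMatrix q p r s u v) N T V t τ := by
  have hrev : ∀ i : Fin 3, (fun j : Fin 3 => nodeCoeff (schemeMatrix q p r s u v) i j.rev) =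
      fun j => ∑ k, schemeMatrix q p r s u v (Fin.castLE (by norm_num) i).rev k * G k j := by
    intro i
    funext j
    fin_cases i <;> fin_cases j <;>
      simp [nodeCoeff, schemeMatrix, G, Fin.sum_univ_three, Fin.rev]
  have h1 := hrev 1
  have h0 := hrev 0
  simp only [upsilon, composition, smul_sum_alpha_eq, barV, Matrix.cons_val_zero,
    Matrix.cons_val_one, Matrix.cons_val, rowSum_nodeCoeff, h1, h0]
  have e0 : schemeMatrix q p r s u v 0 0 = 0 := rfl
  have e4 : schemeMatrix q p r s u v 4 0 = 0 := rfl
  rw [e0, e4]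
  simp only [Complex.ofReal_zero, zero_smul, zero_add]
  rfl

theorem isDiag_exp_averagedPotential {N : ℕ} (c : Fin 3 → ℝ) (z : ℂ) (V : ℝ → Fin N → ℝ)
    (t τ : ℝ) : (NormedSpace.exp (z • averagedPotential c V t τ)).IsDiag := by
  have h : z • averagedPotential c V t τ = Matrix.diagonal fun k =>
      z * ∑ j, (c j : ℂ) * (V (t + node j * τ) k : ℂ) := by
    ext i k
    by_cases hik : i = k <;>
      simp [averagedPotential, nodePotential, potential, Matrix.sum_apply, hik]
  rw [h, Matrix.exp_diagonal]
  exact Matrix.isDiag_diagonal _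

theorem mul_mem_Icc {x y a b c d : ℝ} (ha : 0 ≤ a) (hc : 0 ≤ c) (hx : x ∈ Set.Icc a b)
    (hy : y ∈ Set.Icc c d) : x * y ∈ Set.Icc (a * c) (b * d) :=
  ⟨mul_le_mul hx.1 hy.1 hc (ha.trans hx.1),
    mul_le_mul hx.2 hy.2 (hc.trans hy.1) ((ha.trans hx.1).trans hx.2)⟩

theorem one_div_mem_Icc {x a b : ℝ} (ha : 0 < a) (hx : x ∈ Set.Icc a b) :
    1 / x ∈ Set.Icc (1 / b) (1 / a) :=
  ⟨one_div_le_one_div_of_le (ha.trans_le hx.1) hx.2, one_div_le_one_div_of_le ha hx.1⟩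

theorem sqrt_fifteen_mem : √15 ∈ Set.Icc (3.8729833462074168851792653997 : ℝ)
    3.8729833462074168851792653998 :=
  ⟨Real.le_sqrt_of_sq_le (by norm_num), Real.sqrt_le_iff.2 ⟨by norm_num, by norm_num⟩⟩

/-- Interval arithmetic with nonnegative endpoints. The negatives of q and r are used because they
are positive at this root, which lets products and reciprocals be bounded monotonically. Together
with p, the three enclosed quantities determine all node coefficients linearly. -/
theorem sqrt_fifteen_mul_mem {p q r s : ℝ} (h : p ∈
    Set.Icc (0.567040718865477427574416649845032 : ℝ) 0.567040718865477427574416649845033)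
    (hq : q = -1 / 12 - (1 - p) * r) (hr : r = -1 / (60 * (p * (1 - p) ^ 2)))
    (hs : s = p / 12 + 1 / (60 * (1 - p))) :
    √15 * -q ∈ Set.Icc (0.0598228879528083223462 : ℝ) 0.0598228879528083223463 ∧
      √15 * -r ∈ Set.Icc (0.60727587024390585246484 : ℝ) 0.60727587024390585246485 ∧
      s ∈ Set.Icc (0.085748160282456073452455 : ℝ) 0.085748160282456073452456 := by
  have hz : 1 - p ∈ Set.Icc (0.432959281134522572425583350154967 : ℝ)
      0.432959281134522572425583350154968 := ⟨by linarith [h.2], by linarith [h.1]⟩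
  have h60 : (60 : ℝ) ∈ Set.Icc (60 : ℝ) 60 := ⟨le_rfl, le_rfl⟩
  have hr' : -r = 1 / (60 * (p * ((1 - p) * (1 - p)))) := by
    rw [hr, neg_div, neg_neg, sq]
  have hR := one_div_mem_Icc (by norm_num)
    (mul_mem_Icc (by norm_num) (by norm_num) h60
      (mul_mem_Icc (by norm_num) (by norm_num) h
        (mul_mem_Icc (by norm_num) (by norm_num) hz hz)))
  have hS := one_div_mem_Icc (by norm_num) (mul_mem_Icc (by norm_num) (by norm_num) h60 hz)
  rw [← hr'] at hR
  have hzR := mul_mem_Icc (by norm_num) (by norm_num) hz hR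
  have hQ : -q ∈ Set.Icc (0.01544620325088392956391 : ℝ) 0.01544620325088392956392 := by
    rw [show -q = 1 / 12 - (1 - p) * -r by rw [hq]; ring]
    constructor
    · refine le_trans ?_ (sub_le_sub_left hzR.2 _)
      norm_num
    · refine le_trans (sub_le_sub_left hzR.1 _) ?_
      norm_num
  have hwQ := mul_mem_Icc (by norm_num) (by norm_num) sqrt_fifteen_mem hQ
  have hwR := mul_mem_Icc (by norm_num) (by norm_num) sqrt_fifteen_mem hR
  refine ⟨⟨le_trans ?_ hwQ.1, hwQ.2.trans ?_⟩, ⟨le_trans ?_ hwR.1, hwR.2.trans ?_⟩,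
    ⟨?_, ?_⟩⟩
  · norm_num
  · norm_num
  · norm_num
  · norm_num
  · rw [hs]
    refine le_trans ?_ (add_le_add (div_le_div_of_nonneg_right h.1 (by norm_num)) hS.1)
    norm_num
  · rw [hs]
    refine (add_le_add (div_le_div_of_nonneg_right h.2 (by norm_num)) hS.2).trans ?_
    norm_num

theorem nodeCoeff_consistentMatrix (q p r s : ℝ) : nodeCoeff (consistentMatrix q p r s) =
    !![√15 * -q / 3, 0, -(√15 * -q / 3);
      √15 * -r / 3 + 10 / 3 * s, p - 20 / 3 * s, 10 / 3 * s - √15 * -r / 3;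
      10 / 3 * (1 / 12 - 2 * s), 1 - 2 * p - 20 / 3 * (1 / 12 - 2 * s),
        10 / 3 * (1 / 12 - 2 * s)] := by
  ext i j
  fin_cases i <;> fin_cases j <;>
    simp [nodeCoeff, consistentMatrix, schemeMatrix, G, Fin.sum_univ_three] <;> ring

/-- The coefficient matrix of the scheme of order six that belongs to a root `p`. -/
noncomputable def rootMatrix (p : ℝ) : Matrix (Fin 5) (Fin 3) ℝ :=
  consistentMatrix (-1 / 12 - (1 - p) * (-1 / (60 * (p * (1 - p) ^ 2)))) p
    (-1 / (60 * (p * (1 - p) ^ 2))) (p / 12 + 1 / (60 * (1 - p)))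

/-- The sixth-order conditions have only one admissible solution. -/
theorem eq_rootMatrix {p : ℝ} (hp : rootPoly p = 0) {y : Matrix (Fin 5) (Fin 3) ℝ}
    (hy : IsAdmissible y) (hy6 : IsOfOrder 6 (composition y)) : y = rootMatrix p := by
  rw [hy.eq_schemeMatrix] at hy6 ⊢
  obtain ⟨hu, hv, h⟩ := sixthOrderEquations_of_isOfOrder hy6
  obtain ⟨h0, hq, hr, hs⟩ := h.rootPoly_eq_zero
  rw [eq_of_rootPoly_eq_zero h0 hp] at hq hr hs hu
  rw [hu, hv, hq, hr, hs, eq_of_rootPoly_eq_zero h0 hp]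
  rfl

end Main

end CommutatorFree

theorem mainTheorem3 :
    ∃ (x : Matrix (Fin 5) (Fin 3) ℝ) (a : Matrix (Fin 3) (Fin 3) ℝ),
      -- `x` satisfies the sixth-order conditions, and every other solution has a larger sum
      CommutatorFree.IsAdmissible x ∧
      CommutatorFree.IsOfOrder 6 (CommutatorFree.composition x) ∧
      (∀ y : Matrix (Fin 5) (Fin 3) ℝ, CommutatorFree.IsAdmissible y →
        CommutatorFree.IsOfOrder 6 (CommutatorFree.composition y) → y ≠ x →
        CommutatorFree.coeffSum x < CommutatorFree.coeffSum y) ∧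
      -- `a` holds the same coefficients in terms of the potentials at the nodes
      (∀ i j : Fin 3, a i j = ∑ k : Fin 3, x (Fin.castLE (by norm_num) i) k *
        CommutatorFree.G k j) ∧
      (∀ (N : ℕ) (T : Matrix (Fin N) (Fin N) ℂ) (V : ℝ → Fin N → ℝ) (t τ : ℝ),
        CommutatorFree.upsilon a N T V t τ = CommutatorFree.composition x N T V t τ) ∧
      -- the scheme is of order six and its outer exponentials are diagonal
      CommutatorFree.IsOfOrder 6 (CommutatorFree.upsilon a) ∧
      (∀ (N : ℕ) (V : ℝ → Fin N → ℝ) (t τ : ℝ),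
        (NormedSpace.exp ((-Complex.I * τ) • CommutatorFree.barV a V t τ 0)).IsDiag ∧
        (NormedSpace.exp ((-Complex.I * τ) • CommutatorFree.barV a V t τ 4)).IsDiag) ∧
      -- the coefficients, correctly rounded to the digits shown
      |a 0 0 - 0.01994096265093610745| ≤ 0.5 * 10 ^ (-20 : ℤ) ∧
      a 0 1 = 0 ∧
      a 0 2 = -a 0 0 ∧
      |a 1 0 - 0.4882524910228221957| ≤ 0.5 * 10 ^ (-19 : ℤ) ∧
      |a 1 1 - (-0.0046136830175630621)| ≤ 0.5 * 10 ^ (-19 : ℤ) ∧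
      |a 1 2 - 0.0834019108602182940| ≤ 0.5 * 10 ^ (-19 : ℤ) ∧
      |a 2 0 - (-0.29387662410526271191)| ≤ 0.5 * 10 ^ (-20 : ℤ) ∧
      |a 2 1 - 0.4536718104795705687| ≤ 0.5 * 10 ^ (-19 : ℤ) ∧
      a 2 2 = a 2 0 ∧
      |CommutatorFree.rowSum a 1 - 0.56704071886547742757| ≤ 0.5 * 10 ^ (-20 : ℤ) ∧
      CommutatorFree.rowSum a 2 = 1 - 2 * CommutatorFree.rowSum a 1 ∧
      |CommutatorFree.rowSum a 2 - (-0.13408143773095485515)| ≤ 0.5 * 10 ^ (-20 : ℤ) := by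
  open CommutatorFree in
  obtain ⟨p, hroot, hp⟩ := exists_rootPoly_eq_zero
  have hx6 : IsOfOrder 6 (composition (rootMatrix p)) :=
    (sixthOrderEquations_of_rootPoly hroot).isOfOrder
  have hups : ∀ (N : ℕ) (T : Matrix (Fin N) (Fin N) ℂ) (V : ℝ → Fin N → ℝ) (t τ : ℝ),
      upsilon (nodeCoeff (rootMatrix p)) N T V t τ = composition (rootMatrix p) N T V t τ :=
    fun N T V t τ => upsilon_nodeCoeff _ _ _ _ _ _ T V t τ
  obtain ⟨⟨hQ1, hQ2⟩, ⟨hR1, hR2⟩, ⟨hS1, hS2⟩⟩ := sqrt_fifteen_mul_mem hp rfl rfl rfl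
  obtain ⟨hp1, hp2⟩ := hp
  have s1 : rowSum (nodeCoeff (rootMatrix p)) 1 = p := rowSum_nodeCoeff _ _
  have s2 : rowSum (nodeCoeff (rootMatrix p)) 2 = 1 - 2 * p := rowSum_nodeCoeff _ _
  have hdiag : ∀ (N : ℕ) (V : ℝ → Fin N → ℝ) (t τ : ℝ),
      (NormedSpace.exp ((-Complex.I * τ) • barV (nodeCoeff (rootMatrix p)) V t τ 0)).IsDiag ∧
      (NormedSpace.exp ((-Complex.I * τ) • barV (nodeCoeff (rootMatrix p)) V t τ 4)).IsDiag :=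
    fun N V t τ => ⟨isDiag_exp_averagedPotential (nodeCoeff (rootMatrix p) 0) _ _ _ _,
      isDiag_exp_averagedPotential (fun j => nodeCoeff (rootMatrix p) 0 j.rev) _ _ _ _⟩
  refine ⟨rootMatrix p, nodeCoeff (rootMatrix p), isAdmissible_schemeMatrix _ _ _ _ _ _, hx6,
    -- By uniqueness there is no second solution to compare coefficient sums with.
    fun y hy hy6 hne => absurd (eq_rootMatrix hroot hy hy6) hne, fun _ _ => rfl, hups, ?_,
    hdiag, ?_⟩
  · have : upsilon (nodeCoeff (rootMatrix p)) = composition (rootMatrix p) := by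
      funext N T V t τ
      exact hups N T V t τ
    rw [this]
    exact hx6
  · rw [s1, s2, rootMatrix, nodeCoeff_consistentMatrix]
    -- With the nonlinear expressions replaced by variables, each rounding claim is a linear
    -- inequality in them and p, and the exact relations become trivial.
    generalize √15 * -(-1 / (60 * (p * (1 - p) ^ 2))) = wR at *
    generalize √15 * -(-1 / 12 - (1 - p) * (-1 / (60 * (p * (1 - p) ^ 2)))) = wQ at *
    generalize p / 12 + 1 / (60 * (1 - p)) = S at *
    clear hups hx6 s1 s2 hroot
    simp only [Matrix.of_apply, Matrix.cons_val', Matrix.cons_val_zero, Matrix.cons_val_one,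
      Matrix.cons_val, abs_le]
    norm_num only at *
    refine ⟨⟨?_, ?_⟩, trivial, trivial, ⟨?_, ?_⟩, ⟨?_, ?_⟩, ⟨?_, ?_⟩, ⟨?_, ?_⟩, ⟨?_, ?_⟩, trivial,
      ⟨?_, ?_⟩, trivial, ?_, ?_⟩ <;> linarith
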